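/- Let $n\ge 1$ and let $\gamma\subset\mathbb{C}$ be a simple closed analytic polynomial curve of degree $n$, that is, $\gamma=h(\{|w|=1\})$ with $$h(w)=rw+a_0+a_1w^{-1}+\cdots+a_nw^{-n},\qquad r>0,\ a_j\in\mathbb{C},\ a_n\neq 0,$$ where $h$ is injective on the unit circle and $h'(w)\ne 0$ for $|w|=1$. Let $D$ be the interior domain of $\gamma$ (the bounded part of $\mathbb{C}\setminus\gamma$). A Schwarz function of $\gamma$ is an analytic function $S$ on a connected open neighbourhood $\Omega$ of $\gamma$ with $S(z)=\bar z$ for $z\in\gamma$. For an open set $G$, a point $p\in G$ is called a branch point of $S$ in $G$ if the germ of $S$ at some point of $\gamma$ can be continued analytically along a path, lying in $G$ except possibly for its starting point on $\gamma$, to a germ $g$ at a point $q$ of a punctured disc $\{0<|z-p|<\varepsilon\}$ with $\{|z-p|<\varepsilon\}\subset G$, such that $g$ can be continued analytically along every path in this punctured disc starting at $q$, and its continuation along some closed path in the punctured disc returns to $q$ with a germ different from $g$. Then $\gamma$ has a Schwarz function, and for every Schwarz function $S$ of $\gamma$, on a connected open neighbourhood $\Omega$ of $\gamma$: 1. $S$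 has a branch point in $D$; 2. the branch points do not touch $\gamma$: there is an open set $N$ with $\gamma\subset N\subset\Omega$ such that no point of $N$ is a branch point of $S$ in $\Omega$ or a branch point of $S$ in $D$. -/

import Mathlib

open Set Filter Topology Metric
open scoped unitInterval ComplexConjugate

noncomputable section

namespace PolyCurve

/-- The Laurent polynomial `r w + a₀ + a₁ w⁻¹ + ⋯ + aₙ w⁻ⁿ`. -/
def param (r : ℝ) (n : ℕ) (a : ℕ → ℂ) (w : ℂ) : ℂ :=
  (r : ℂ) * w + ∑ j ∈ Finset.range (n + 1), a j * (w ^ j)⁻¹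

/-- `γ` is a simple closed analytic polynomial curve of degree `n`: it is the image of the unit
circle under a map `r w + a₀ + ⋯ + aₙ w⁻ⁿ` with `r > 0` and `aₙ ≠ 0`, which is injective on the
unit circle and has no critical point there. -/
def IsSimpleAnalyticPolynomialCurve (n : ℕ) (γ : Set ℂ) : Prop :=
  ∃ (r : ℝ) (a : ℕ → ℂ), 0 < r ∧ a n ≠ 0 ∧
    γ = param r n a '' sphere (0 : ℂ) 1 ∧
    InjOn (param r n a) (sphere (0 : ℂ) 1) ∧
    ∀ w ∈ sphere (0 : ℂ) 1, deriv (param r n a) w ≠ 0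

/-- The interior domain of a closed curve `γ`: the points off `γ` whose connected component in
the complement of `γ` is bounded. -/
def interiorDomain (γ : Set ℂ) : Set ℂ :=
  {z | z ∈ γᶜ ∧ Bornology.IsBounded (connectedComponentIn γᶜ z)}

/-- `S` is the Schwarz function of `γ` on the connected open neighbourhood `Ω` of `γ`. -/
structure IsSchwarzFunction (γ Ω : Set ℂ) (S : ℂ → ℂ) : Prop where
  isOpen : IsOpen Ω
  isConnected : IsConnected Ω
  subset : γ ⊆ Ω
  analytic : AnalyticOnNhd ℂ S Ω
  eq_conj : ∀ z ∈ γ, S z = conj z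

/-- The germ of `f` at `x` can be continued analytically along the path `c`, and the continuation
ends with the germ of `g` at `y`. The function `F t` represents the germ carried at the point
`c t`. -/
def ContinuesTo {x y : ℂ} (c : Path x y) (f g : ℂ → ℂ) : Prop :=
  ∃ F : I → ℂ → ℂ,
    (∀ t, AnalyticAt ℂ (F t) (c t)) ∧
    (∀ t, ∀ᶠ s in 𝓝 t, F s =ᶠ[𝓝 (c s)] F t) ∧
    F 0 =ᶠ[𝓝 x] f ∧ F 1 =ᶠ[𝓝 y] g

/-- The germ `g` at `q` has a (nontrivial) branching around `p` in the punctured disc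
`ball p ε \ {p}`: it can be continued along every path in the punctured disc, and along some
closed path in it the continuation comes back to `q` with a different germ. -/
def BranchesAround (g : ℂ → ℂ) (q p : ℂ) (ε : ℝ) : Prop :=
  (∀ (y : ℂ) (c : Path q y), (∀ t, c t ∈ ball p ε \ {p}) → ∃ g' : ℂ → ℂ, ContinuesTo c g g') ∧
  ∃ (l : Path q q) (g' : ℂ → ℂ), (∀ t, l t ∈ ball p ε \ {p}) ∧ ContinuesTo l g g' ∧
    ¬ g' =ᶠ[𝓝 q] g

/-- `p` is a branch point in the open set `G` of the function `S`, given near `γ`: the germ of `S`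
at some point of `γ`, continued analytically along a path that runs in `G` after leaving its
starting point, gives near `p` a germ that branches around `p`. -/
def IsBranchPoint (S : ℂ → ℂ) (γ G : Set ℂ) (p : ℂ) : Prop :=
  ∃ ε : ℝ, 0 < ε ∧ ball p ε ⊆ G ∧
    ∃ z ∈ γ, ∃ q ∈ ball p ε \ {p}, ∃ (c : Path z q) (g : ℂ → ℂ),
      (∀ t : I, 0 < t → c t ∈ G) ∧ ContinuesTo c S g ∧ BranchesAround g q p ε

end PolyCurve

end

/-! Write `h` for `param` and `T` for `dual`, so that `T = conj h` on the unit circle. By the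
identity theorem every Schwarz function satisfies `S ∘ h = T` near the circle
(`IsSchwarzFunction.eventually_comp_param`), so `S` is a branch of the algebraic function `T ∘ h⁻¹`.
Being such a branch is the vanishing of a resultant, and hence survives analytic continuation. Away
from the finitely many critical values of `h` the branches extend to discs, so only critical values
can be branch points. Deleting from `Ω` those not on `γ` gives the neighbourhood `N`: a branch point
in the interior domain is not on `γ`, and none lies in `Ω` because `S` is analytic there.

For the existence of a branch point, suppose there is none in the interior domain. A germ that does
not branch around a critical value extends over it, because branches of `T ∘ h⁻¹` are bounded over
bounded sets. Hence `S` continues along all paths there. Inside a curve parallel to `γ`, the image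
of a circle of radius near 1, monodromy gives an analytic function `f` equal to `S` on the parallel
curve (`exists_diffContOnCl_of_continuesTo`). There `S` is within a small `δ` of `conj z`. The real
and imaginary parts of `f z - conj z` are harmonic, so `f` stays within `2δ` of `conj z` inside. But
on a disc of radius `ρ` no analytic function comes closer to `conj z` than `ρ`
(`le_of_forall_norm_sub_conj_le`), a contradiction for small `δ`.

The Jordan curve theorem and simple connectedness are replaced by winding numbers. The factorization
`h w - h v = (w - v) Q(w, v)` shows that the index jumps by one across `γ`, so one side has index
`±1` (`exists_halfAnnulus_hasWinding`). Index `±1` makes the filled parallel curve a retract of the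
plane (`exists_retraction`), and monodromy is carried out along the images of segments under the
retraction. -/

noncomputable section

namespace PolyCurve

section

/-! ### Sections of the sheaf of analytic germs along a map -/

/-- A family of functions `F x`, analytic at `r x`, whose germs at `r x` vary coherently with `x`. -/
structure GermSection {X : Type*} [TopologicalSpace X] (r : X → ℂ) (F : X → ℂ → ℂ) : Prop where
  analyticAt : ∀ x, AnalyticAt ℂ (F x) (r x)
  eventuallyEq : ∀ x, ∀ᶠ y in 𝓝 x, F y =ᶠ[𝓝 (r y)] F x

/-- The identity theorem on a disc where both functions are analytic. It makes the set where two
germ sections agree closed. -/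
theorem eventually_imp_eventuallyEq {f g : ℂ → ℂ} {x : ℂ} (hf : AnalyticAt ℂ f x)
    (hg : AnalyticAt ℂ g x) : ∀ᶠ y in 𝓝 x, f =ᶠ[𝓝 y] g → f =ᶠ[𝓝 x] g := by
  obtain ⟨ε, hε, hb⟩ := Metric.eventually_nhds_iff_ball.1
    (hf.eventually_analyticAt.and hg.eventually_analyticAt)
  filter_upwards [ball_mem_nhds x hε] with y hy h
  have := AnalyticOnNhd.eqOn_of_preconnected_of_eventuallyEq (fun z hz => (hb z hz).1)
    (fun z hz => (hb z hz).2) (convex_ball x ε).isPreconnected hy h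
  exact this.eventuallyEq_of_mem (ball_mem_nhds x hε)

namespace GermSection

variable {X Y : Type*} [TopologicalSpace X] [TopologicalSpace Y] {r : X → ℂ} {F G : X → ℂ → ℂ}

theorem comp (hF : GermSection r F) {k : Y → X} (hk : Continuous k) :
    GermSection (r ∘ k) (F ∘ k) :=
  ⟨fun y => hF.analyticAt (k y), fun y => hk.continuousAt.eventually (hF.eventuallyEq (k y))⟩

theorem const {g : ℂ → ℂ} (hg : ∀ x, AnalyticAt ℂ g (r x)) : GermSection r fun _ => g :=
  ⟨hg, fun _ => Eventually.of_forall fun _ => EventuallyEq.rfl⟩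

/-- Uniqueness of continuation: the set of agreement is clopen and nonempty. -/
theorem eventuallyEq_of_eventuallyEq [PreconnectedSpace X] (hr : Continuous r)
    (hF : GermSection r F) (hG : GermSection r G) {x₀ : X} (h₀ : F x₀ =ᶠ[𝓝 (r x₀)] G x₀) (x : X) :
    F x =ᶠ[𝓝 (r x)] G x := by
  have hclopen : IsClopen {x | F x =ᶠ[𝓝 (r x)] G x} := by
    constructor
    · rw [← isOpen_compl_iff, isOpen_iff_mem_nhds]
      intro x hx
      filter_upwards [hF.eventuallyEq x, hG.eventuallyEq x, hr.continuousAt.eventually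
        (eventually_imp_eventuallyEq (hF.analyticAt x) (hG.analyticAt x))] with y h1 h2 h3 h4
      exact hx (h3 (h1.symm.trans (EventuallyEq.trans h4 h2)))
    · rw [isOpen_iff_mem_nhds]
      intro x hx
      filter_upwards [hF.eventuallyEq x, hG.eventuallyEq x, hr.continuousAt.eventually
        (Filter.Eventually.eventually_nhds hx)] with y h1 h2 h3
      exact h1.trans (EventuallyEq.trans h3 h2.symm)
  have := hclopen.eq_univ ⟨x₀, h₀⟩
  exact this.ge (mem_univ x)

end GermSection

theorem continuesTo_iff {x y : ℂ} {c : Path x y} {f g : ℂ → ℂ} :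
    ContinuesTo c f g ↔ ∃ F, GermSection c F ∧ F 0 =ᶠ[𝓝 x] f ∧ F 1 =ᶠ[𝓝 y] g :=
  ⟨fun ⟨F, h1, h2, h3⟩ => ⟨F, ⟨h1, h2⟩, h3⟩, fun ⟨F, h, h3⟩ => ⟨F, h.1, h.2, h3⟩⟩

namespace ContinuesTo

variable {x y z : ℂ} {c : Path x y} {f g g' : ℂ → ℂ}

theorem analyticAt (h : ContinuesTo c f g) : AnalyticAt ℂ g y := by
  obtain ⟨F, h1, -, -, h4⟩ := h
  have := h1 1
  rw [c.target] at this
  exact this.congr h4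

theorem unique (h : ContinuesTo c f g) (h' : ContinuesTo c f g') : g =ᶠ[𝓝 y] g' := by
  obtain ⟨F, hF, h0, h1⟩ := continuesTo_iff.1 h
  obtain ⟨F', hF', h0', h1'⟩ := continuesTo_iff.1 h'
  have := hF.eventuallyEq_of_eventuallyEq c.continuous hF' (x₀ := 0)
    (by rw [c.source]; exact h0.trans h0'.symm) 1
  rw [c.target] at this
  exact h1.symm.trans (this.trans h1')

theorem of_analyticAt (h : ∀ t, AnalyticAt ℂ f (c t)) : ContinuesTo c f f :=
  continuesTo_iff.2 ⟨fun _ => f, GermSection.const h, EventuallyEq.rfl, EventuallyEq.rfl⟩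

theorem congr_left {f' : ℂ → ℂ} (h : ContinuesTo c f g) (hf : f =ᶠ[𝓝 x] f') :
    ContinuesTo c f' g := by
  obtain ⟨F, h1, h2, h3, h4⟩ := h
  exact ⟨F, h1, h2, h3.trans hf, h4⟩

theorem trans {d : Path y z} {k : ℂ → ℂ} (h : ContinuesTo c f g) (h' : ContinuesTo d g k) :
    ContinuesTo (c.trans d) f k := by
  obtain ⟨F, h1, h2, h3, h4⟩ := h
  obtain ⟨F', h1', h2', h3', h4'⟩ := h'
  have hp1 : ∀ s : I, (s : ℝ) ≤ 1 / 2 → (c.trans d) s = c (Set.projIcc 0 1 zero_le_one (2 * s)) := by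
    intro s hs
    rw [Path.trans_apply, dif_pos hs]
    congr 1
    rw [projIcc_of_mem zero_le_one ((unitInterval.mul_pos_mem_iff zero_lt_two).2 ⟨s.2.1, hs⟩)]
  have hp2 : ∀ s : I, 1 / 2 ≤ (s : ℝ) →
      (c.trans d) s = d (Set.projIcc 0 1 zero_le_one (2 * s - 1)) := by
    intro s hs
    rcases hs.eq_or_lt with hs | hs
    · rw [hp1 s hs.symm.le, ← hs]
      norm_num
    rw [Path.trans_apply, dif_neg (not_le.2 hs)]
    congr 1
    rw [projIcc_of_mem zero_le_one (unitInterval.two_mul_sub_one_mem_iff.2 ⟨hs.le, s.2.2⟩)]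
  have hc1 : Continuous fun s : I => Set.projIcc (0 : ℝ) 1 zero_le_one (2 * s) := by fun_prop
  have hc2 : Continuous fun s : I => Set.projIcc (0 : ℝ) 1 zero_le_one (2 * s - 1) := by fun_prop
  refine continuesTo_iff.2 ⟨fun s => if (s : ℝ) ≤ 1 / 2 then
    F (Set.projIcc 0 1 zero_le_one (2 * s)) else F' (Set.projIcc 0 1 zero_le_one (2 * s - 1)),
    ⟨fun s => ?_, fun s => ?_⟩, ?_, ?_⟩
  · by_cases hs : (s : ℝ) ≤ 1 / 2
    · rw [hp1 s hs, if_pos hs]; exact h1 _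
    · rw [hp2 s (not_le.1 hs).le, if_neg hs]; exact h1' _
  · rcases lt_trichotomy (s : ℝ) (1 / 2) with hs | hs | hs
    · have e : ∀ᶠ u : I in 𝓝 s, (u : ℝ) < 1 / 2 :=
        continuous_subtype_val.continuousAt.eventually (eventually_lt_nhds hs)
      filter_upwards [e, hc1.continuousAt.eventually (h2 _)] with u hu hu2
      rw [hp1 u hu.le, if_pos hu.le, if_pos hs.le]
      exact hu2
    -- At the midpoint both pieces carry the germ of `g` at `y`. `F 1` and `F' 0` therefore agree on
    -- a whole neighbourhood of `y`, which covers both sides of the junction.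
    · have hF : F (Set.projIcc 0 1 zero_le_one (2 * (s : ℝ))) = F 1 := by rw [hs]; norm_num
      have hF' : F' (Set.projIcc 0 1 zero_le_one (2 * (s : ℝ) - 1)) = F' 0 := by rw [hs]; norm_num
      have hd : (c.trans d) s = y := by rw [hp1 s hs.le, hs]; norm_num
      have hgl : F' 0 =ᶠ[𝓝 y] F 1 := h3'.trans h4.symm
      have hgl2 := (c.trans d).continuous.continuousAt.eventually
        (hd.symm ▸ hgl.eventually_nhds : ∀ᶠ u in 𝓝 ((c.trans d) s), F' 0 =ᶠ[𝓝 u] F 1)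
      filter_upwards [hc1.continuousAt.eventually (h2 _), hc2.continuousAt.eventually (h2' _),
        hgl2] with u hu hu2 hu3
      rw [if_pos hs.le, hF]
      rw [hF] at hu
      rw [hF'] at hu2
      by_cases hu' : (u : ℝ) ≤ 1 / 2
      · rw [if_pos hu', hp1 u hu']
        exact hu
      · rw [if_neg hu']
        refine EventuallyEq.trans ?_ hu3
        rw [hp2 u (not_le.1 hu').le]
        exact hu2
    · have e : ∀ᶠ u : I in 𝓝 s, 1 / 2 < (u : ℝ) :=
        continuous_subtype_val.continuousAt.eventually (eventually_gt_nhds hs)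
      filter_upwards [e, hc2.continuousAt.eventually (h2' _)] with u hu hu2
      rw [hp2 u hu.le, if_neg (not_le.2 hu), if_neg (not_le.2 hs)]
      exact hu2
  · norm_num; exact h3
  · norm_num; exact h4'

/-- Analytic continuation along a path is stable under small perturbations of the path. -/
theorem perturb (h : ContinuesTo c f g) : ∃ δ > 0, ∀ (x' y' : ℂ) (c' : Path x' y'),
    (∀ t, dist (c' t) (c t) < δ) → ContinuesTo c' f g := by
  obtain ⟨F, h1, h2, h3, h4⟩ := h
  have hρ : ∀ t, ∃ ρ > 0, AnalyticOnNhd ℂ (F t) (ball (c t) ρ) := fun t => by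
    obtain ⟨ρ, hρ, hb⟩ := Metric.eventually_nhds_iff_ball.1 (h1 t).eventually_analyticAt
    exact ⟨ρ, hρ, hb⟩
  choose ρ hρ hFa using hρ
  have hU : ∀ t, ∃ U : Set I, IsOpen U ∧ t ∈ U ∧ ∀ s ∈ U, F s =ᶠ[𝓝 (c s)] F t ∧
      dist (c s) (c t) < ρ t / 2 := fun t => by
    have : ∀ᶠ s in 𝓝 t, F s =ᶠ[𝓝 (c s)] F t ∧ dist (c s) (c t) < ρ t / 2 :=
      (h2 t).and (c.continuous.continuousAt.eventually (ball_mem_nhds _ (half_pos (hρ t))))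
    obtain ⟨U, hU, ho, ht⟩ := _root_.eventually_nhds_iff.1 this
    exact ⟨U, ho, ht, hU⟩
  choose U hUo hUt hUs using hU
  -- By compactness finitely many functions `F τ`, each on its own disc, represent all germs along
  -- the path. The original path uses only half of each radius, which leaves room for the perturbed
  -- one.
  obtain ⟨T, hT⟩ := isCompact_univ.elim_finite_subcover U hUo
    (fun t _ => mem_iUnion.2 ⟨t, hUt t⟩)
  have hτ : ∀ t, ∃ τ ∈ T, t ∈ U τ := fun t => by
    have := hT (mem_univ t)
    simpa using this
  choose τ hτT hτU using hτ
  have hglue : ∀ s t, c s ∈ ball (c (τ t)) (ρ (τ t)) → F s =ᶠ[𝓝 (c s)] F (τ t) →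
      EqOn (F (τ s)) (F (τ t)) (ball (c (τ s)) (ρ (τ s)) ∩ ball (c (τ t)) (ρ (τ t))) := by
    intro s t hst hF
    refine AnalyticOnNhd.eqOn_of_preconnected_of_eventuallyEq (z₀ := c s)
      ((hFa _).mono inter_subset_left) ((hFa _).mono inter_subset_right)
      ((convex_ball _ _).inter (convex_ball _ _)).isPreconnected ⟨?_, hst⟩ ?_
    · have := (hUs _ _ (hτU s)).2
      exact this.trans (half_lt_self (hρ _))
    · exact ((hUs _ _ (hτU s)).1.symm.trans hF)
  obtain ⟨δ₁, hδ₁, hδ₁'⟩ : ∃ δ > 0, ∀ t ∈ T, δ ≤ ρ t / 2 := by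
    have : ∀ᶠ δ in 𝓝[>] (0 : ℝ), ∀ t ∈ T, δ ≤ ρ t / 2 := by
      rw [Finset.eventually_all]
      intro t _
      filter_upwards [Ioo_mem_nhdsGT (half_pos (hρ t))] with δ hδ
      exact hδ.2.le
    obtain ⟨δ, h, h'⟩ := (this.and self_mem_nhdsWithin).exists
    exact ⟨δ, h', h⟩
  have e0 : F (τ 0) =ᶠ[𝓝 x] f := by
    have := (hUs _ _ (hτU 0)).1
    rw [c.source] at this
    exact this.symm.trans h3
  have e1 : F (τ 1) =ᶠ[𝓝 y] g := by
    have := (hUs _ _ (hτU 1)).1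
    rw [c.target] at this
    exact this.symm.trans h4
  obtain ⟨δ₂, hδ₂, hδ₂'⟩ := Metric.eventually_nhds_iff_ball.1 e0.eventually_nhds
  obtain ⟨δ₃, hδ₃, hδ₃'⟩ := Metric.eventually_nhds_iff_ball.1 e1.eventually_nhds
  refine ⟨min δ₁ (min δ₂ δ₃), by positivity, fun x' y' c' hc' => ?_⟩
  have hc1 : ∀ s t, dist (c s) (c (τ t)) < ρ (τ t) / 2 → c' s ∈ ball (c (τ t)) (ρ (τ t)) := by
    intro s t hst
    have := hδ₁' _ (hτT t)
    have h5 := (hc' s).trans_le (min_le_left _ _)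
    rw [mem_ball]
    linarith [dist_triangle (c' s) (c s) (c (τ t))]
  refine continuesTo_iff.2 ⟨fun t => F (τ t), ⟨fun t => hFa _ _ (hc1 t t (hUs _ _ (hτU t)).2),
    fun t => ?_⟩, ?_, ?_⟩
  · filter_upwards [(hUo (τ t)).mem_nhds (hτU t)] with s hs
    obtain ⟨hs1, hs2⟩ := hUs _ _ hs
    refine (hglue s t (hs2.trans (half_lt_self (hρ _))) hs1).eventuallyEq_of_mem
      ((isOpen_ball.inter isOpen_ball).mem_nhds ⟨hc1 s s (hUs _ _ (hτU s)).2, hc1 s t hs2⟩)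
  · have := hδ₂' x' (by
      have := (hc' 0).trans_le ((min_le_right _ _).trans (min_le_left _ _))
      rwa [c.source, c'.source] at this)
    exact this
  · have := hδ₃' y' (by
      have := (hc' 1).trans_le ((min_le_right _ _).trans (min_le_right _ _))
      rwa [c.target, c'.target] at this)
    exact this

end ContinuesTo

/-- The image under `r` of the segment from `x` to `y`. -/
def segmentPath {r : ℂ → ℂ} (hr : Continuous r) (x y : ℂ) : Path (r x) (r y) where
  toFun t := r (x + (t : ℝ) * (y - x))
  continuous_toFun := by fun_prop
  source' := by simp
  target' := by simp

theorem segmentPath_apply {r : ℂ → ℂ} (hr : Continuous r) (x y : ℂ) (t : I) :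
    segmentPath hr x y t = r (x + (t : ℝ) * (y - x)) := rfl

/-- Monodromy: if a germ can be continued along the images of all segments issued from `x₀`, then
the continuations form a section over the whole plane. -/
theorem exists_germSection_of_segmentPath {r : ℂ → ℂ} (hr : Continuous r) {x₀ : ℂ} {f : ℂ → ℂ}
    (H : ∀ x, ∃ g, ContinuesTo (segmentPath hr x₀ x) f g) :
    ∃ F : ℂ → ℂ → ℂ, GermSection r F ∧ F x₀ =ᶠ[𝓝 (r x₀)] f := by
  choose F hF using H
  refine ⟨F, ⟨fun x => (hF x).analyticAt, fun x => ?_⟩, ?_⟩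
  · obtain ⟨δ, hδ, h⟩ := (hF x).perturb
    have hev : ∀ᶠ x' in 𝓝 x, ∀ t ∈ (univ : Set I),
        dist (segmentPath hr x₀ x' t) (segmentPath hr x₀ x t) < δ := by
      refine isCompact_univ.eventually_forall_of_forall_eventually fun t _ => ?_
      have hcont : Continuous fun z : ℂ × I =>
          dist (segmentPath hr x₀ z.1 z.2) (segmentPath hr x₀ x z.2) := by
        simp only [segmentPath_apply]
        fun_prop
      refine hcont.continuousAt.eventually (eventually_lt_nhds ?_)
      simpa using hδ
    filter_upwards [hev] with x' hx'
    exact (hF x').unique (h _ _ _ fun t => hx' t (mem_univ t))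
  · obtain ⟨F', hF', h0, h1⟩ := continuesTo_iff.1 (hF x₀)
    -- The path is constant here, so continuation along it does not change the germ.
    have hc : ∀ t, segmentPath hr x₀ x₀ t = r x₀ := fun t => by simp [segmentPath_apply]
    have h2 : GermSection (segmentPath hr x₀ x₀) fun _ => F' 0 := GermSection.const fun t => by
      have := hF'.analyticAt 0
      rw [hc] at this ⊢
      exact this
    have h3 := hF'.eventuallyEq_of_eventuallyEq (segmentPath hr x₀ x₀).continuous h2 (x₀ := 0)
      EventuallyEq.rfl 1
    rw [hc] at h3
    exact h1.symm.trans (h3.trans h0)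

/-- If the germs of a class all extend to discs of a size depending only on the centre, then they
continue along all paths. -/
theorem exists_continuesTo_of_forall_ball {U : Set ℂ} {P : ℂ → (ℂ → ℂ) → Prop}
    (hext : ∀ p ∈ U, ∃ ε > 0, ∀ q ∈ ball p ε ∩ U, ∀ g, P q g →
      ∃ G, AnalyticOnNhd ℂ G (ball p ε) ∧ G =ᶠ[𝓝 q] g ∧ ∀ q' ∈ ball p ε ∩ U, P q' G)
    {x y : ℂ} (c : Path x y) (hc : ∀ t, c t ∈ U) {f : ℂ → ℂ} (hfa : AnalyticAt ℂ f x)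
    (hf : P x f) : ∃ g, ContinuesTo c f g := by
  choose! ε hε hG using hext
  obtain ⟨t, ht0, htm, ⟨N, hN⟩, hcov⟩ := exists_monotone_Icc_subset_open_cover_unitInterval
    (c := fun s : I => c ⁻¹' ball (c s) (ε (c s)))
    (fun s => isOpen_ball.preimage c.continuous)
    (fun s _ => mem_iUnion.2 ⟨s, mem_ball_self (hε _ (hc s))⟩)
  -- Induction along a subdivision in which each piece of the path stays in one extension disc.
  -- Carrying `P` along is what allows the germ at `t m` to be extended over the next disc.
  have key : ∀ m, ∃ F : I → ℂ → ℂ, (∀ s ≤ t m, AnalyticAt ℂ (F s) (c s) ∧ P (c s) (F s)) ∧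
      (∀ s ≤ t m, ∀ᶠ u in 𝓝 s, u ≤ t m → F u =ᶠ[𝓝 (c u)] F s) ∧ F 0 = f := by
    intro m
    induction m with
    | zero =>
      refine ⟨fun _ => f, fun s hs => ?_, fun s _ => Eventually.of_forall fun u _ =>
        EventuallyEq.rfl, rfl⟩
      rw [ht0] at hs
      rw [le_antisymm hs s.2.1, c.source]
      exact ⟨hfa, hf⟩
    | succ m ih =>
      obtain ⟨F, hF1, hF2, hF3⟩ := ih
      obtain ⟨i, hi⟩ := hcov m
      have htm' : c (t m) ∈ ball (c i) (ε (c i)) := hi ⟨le_rfl, htm m.le_succ⟩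
      obtain ⟨G, hG1, hG2, hG3⟩ := hG (c i) (hc i) (c (t m)) ⟨htm', hc _⟩ (F (t m)) (hF1 _ le_rfl).2
      refine ⟨fun s => if s ≤ t m then F s else G, fun s hs => ?_, fun s hs => ?_, ?_⟩
      · by_cases h : s ≤ t m
        · simp only [h, if_true]; exact hF1 s h
        · simp only [h, if_false]
          have := hi ⟨(not_le.1 h).le, hs⟩
          exact ⟨hG1 _ this, hG3 _ ⟨this, hc s⟩⟩
      · rcases lt_trichotomy s (t m) with h | h | h
        · filter_upwards [hF2 s h.le, eventually_lt_nhds h] with u hu hu' _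
          simpa only [h.le, hu'.le, if_true] using hu hu'.le
        · subst h
          filter_upwards [hF2 _ le_rfl, c.continuous.continuousAt.eventually hG2.eventually_nhds]
            with u hu hu2 _
          by_cases h : u ≤ t m
          · simpa only [h, le_rfl, if_true] using hu h
          · simp only [h, le_rfl, if_true, if_false]
            exact hu2
        · filter_upwards [eventually_gt_nhds h] with u hu _
          simp only [not_le.2 h, not_le.2 hu, if_false]
          exact EventuallyEq.rfl
      · have : (0 : I) ≤ t m := (t m).2.1
        simp only [this, if_true, hF3]
  obtain ⟨F, h1, h2, h3⟩ := key N
  have hle : ∀ s, s ≤ t N := fun s => by rw [hN N le_rfl]; exact s.2.2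
  refine ⟨F 1, continuesTo_iff.2 ⟨F, ⟨fun s => (h1 s (hle s)).1, fun s => ?_⟩, by rw [h3],
    EventuallyEq.rfl⟩⟩
  filter_upwards [h2 s (hle s)] with u hu
  exact hu (hle u)

end

section

/-! ### The Laurent polynomial and its conjugate -/

/-- The Laurent polynomial `r w⁻¹ + conj a₀ + conj a₁ w + ⋯ + conj aₙ wⁿ`, the conjugate of `param`
on the unit circle. -/
def dual (r : ℝ) (n : ℕ) (a : ℕ → ℂ) (w : ℂ) : ℂ :=
  (r : ℂ) * w⁻¹ + ∑ j ∈ Finset.range (n + 1), conj (a j) * w ^ j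

variable {r : ℝ} {n : ℕ} {a : ℕ → ℂ}

theorem analyticAt_param {w : ℂ} (hw : w ≠ 0) : AnalyticAt ℂ (param r n a) w := by
  have : ∀ j, w ^ j ≠ 0 := fun j => pow_ne_zero j hw
  unfold param
  fun_prop (disch := simp [hw])

theorem analyticAt_dual {w : ℂ} (hw : w ≠ 0) : AnalyticAt ℂ (dual r n a) w := by
  unfold dual
  fun_prop (disch := simp [hw])

theorem dual_eq_conj_param {w : ℂ} (hw : w ∈ sphere (0 : ℂ) 1) :
    dual r n a w = conj (param r n a w) := by
  have h : conj w = w⁻¹ := by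
    rw [Complex.inv_def, Complex.normSq_eq_norm_sq, mem_sphere_zero_iff_norm.1 hw]
    simp
  simp [dual, param, h]

/-! ### The algebraic function `T ∘ h⁻¹` and its eliminant. -/

/-- The polynomial `wⁿ (h(w) - z)` in `w`. -/
def paramPoly (r : ℝ) (n : ℕ) (a : ℕ → ℂ) (z : ℂ) : Polynomial ℂ :=
  Polynomial.C (r : ℂ) * Polynomial.X ^ (n + 1) +
    ∑ j ∈ Finset.range (n + 1), Polynomial.C (a j) * Polynomial.X ^ (n - j) -
    Polynomial.C z * Polynomial.X ^ n

/-- The polynomial `w (T(w) - s)` in `w`, where `T` is `dual`. -/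
def dualPoly (r : ℝ) (n : ℕ) (a : ℕ → ℂ) (s : ℂ) : Polynomial ℂ :=
  Polynomial.C (r : ℂ) +
    ∑ j ∈ Finset.range (n + 1), Polynomial.C (conj (a j)) * Polynomial.X ^ (j + 1) -
    Polynomial.C s * Polynomial.X

theorem eval_paramPoly {w : ℂ} (hw : w ≠ 0) (z : ℂ) :
    (paramPoly r n a z).eval w = w ^ n * (param r n a w - z) := by
  have : ∀ j ∈ Finset.range (n + 1), a j * w ^ (n - j) = w ^ n * (a j * (w ^ j)⁻¹) := by
    intro j hj
    rw [pow_sub₀ w hw (Finset.mem_range_succ_iff.1 hj)]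
    ring
  simp only [paramPoly, Polynomial.eval_sub, Polynomial.eval_add, Polynomial.eval_mul,
    Polynomial.eval_C, Polynomial.eval_pow, Polynomial.eval_X, Polynomial.eval_finsetSum, param]
  rw [Finset.sum_congr rfl this, ← Finset.mul_sum]
  ring

theorem eval_zero_paramPoly (hn : 1 ≤ n) (z : ℂ) : (paramPoly r n a z).eval 0 = a n := by
  simp only [paramPoly, Polynomial.eval_sub, Polynomial.eval_add, Polynomial.eval_mul,
    Polynomial.eval_C, Polynomial.eval_pow, Polynomial.eval_X, Polynomial.eval_finsetSum]
  rw [Finset.sum_range_succ, Finset.sum_eq_zero]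
  · simp [show n ≠ 0 by lia]
  · intro j hj
    rw [Finset.mem_range] at hj
    simp [show n - j ≠ 0 by lia]

theorem eval_dualPoly {w : ℂ} (hw : w ≠ 0) (s : ℂ) :
    (dualPoly r n a s).eval w = w * (dual r n a w - s) := by
  simp only [dualPoly, Polynomial.eval_sub, Polynomial.eval_add, Polynomial.eval_mul,
    Polynomial.eval_C, Polynomial.eval_pow, Polynomial.eval_X, Polynomial.eval_finsetSum, dual,
    pow_succ, ← mul_assoc, ← Finset.sum_mul]
  field_simp

theorem natDegree_dualPoly_le (s : ℂ) : (dualPoly r n a s).natDegree ≤ n + 1 := by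
  unfold dualPoly
  refine (Polynomial.natDegree_sub_le _ _).trans (max_le
    ((Polynomial.natDegree_add_le _ _).trans (max_le (by simp) ?_))
    ((Polynomial.natDegree_C_mul_le _ _).trans (by simp)))
  refine Polynomial.natDegree_sum_le_of_forall_le _ _ fun j hj => ?_
  refine (Polynomial.natDegree_C_mul_X_pow_le _ _).trans ?_
  rw [Finset.mem_range] at hj
  lia

theorem coeff_paramPoly (z : ℂ) (k : ℕ) : (paramPoly r n a z).coeff k =
    (paramPoly r n a 0).coeff k - (if k = n then z else 0) := by
  simp only [paramPoly, Polynomial.coeff_sub, Polynomial.coeff_C_mul, Polynomial.coeff_X_pow]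
  split_ifs <;> simp

theorem coeff_dualPoly (s : ℂ) (k : ℕ) : (dualPoly r n a s).coeff k =
    (dualPoly r n a 0).coeff k - (if k = 1 then s else 0) := by
  simp only [dualPoly, Polynomial.coeff_sub, Polynomial.coeff_C_mul, Polynomial.coeff_X,
    eq_comm (a := 1)]
  split_ifs <;> simp

theorem coeff_succ_paramPoly (z : ℂ) : (paramPoly r n a z).coeff (n + 1) = r := by
  simp only [paramPoly, Polynomial.coeff_sub, Polynomial.coeff_add, Polynomial.finsetSum_coeff,
    Polynomial.coeff_C_mul, Polynomial.coeff_X_pow]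
  rw [Finset.sum_eq_zero]
  · simp
  · intro j _
    rw [if_neg (by lia)]
    simp

theorem natDegree_paramPoly (hn : 1 ≤ n) (hr : 0 < r) (z : ℂ) :
    (paramPoly r n a z).natDegree = n + 1 := by
  refine le_antisymm ?_ (Polynomial.le_natDegree_of_ne_zero ?_)
  · unfold paramPoly
    refine (Polynomial.natDegree_sub_le _ _).trans (max_le
      ((Polynomial.natDegree_add_le _ _).trans (max_le
        (Polynomial.natDegree_C_mul_X_pow_le _ _) ?_))
      ((Polynomial.natDegree_C_mul_X_pow_le _ _).trans (by simp)))
    refine Polynomial.natDegree_sum_le_of_forall_le _ _ fun j hj => ?_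
    refine (Polynomial.natDegree_C_mul_X_pow_le _ _).trans ?_
    lia
  · rw [coeff_succ_paramPoly z]
    exact_mod_cast hr.ne'

theorem paramPoly_ne_zero (hn : 1 ≤ n) (hr : 0 < r) (z : ℂ) : paramPoly r n a z ≠ 0 := by
  intro h
  have := natDegree_paramPoly (a := a) hn hr z
  simp [h] at this

/-- `s` is one of the values at `z` of the algebraic function `T ∘ h⁻¹`. -/
def IsAlgValue (r : ℝ) (n : ℕ) (a : ℕ → ℂ) (z s : ℂ) : Prop :=
  ∃ w ≠ 0, param r n a w = z ∧ dual r n a w = s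

/-- The eliminant of `w` from the equations `h(w) = z` and `T(w) = s`. -/
def eliminant (r : ℝ) (n : ℕ) (a : ℕ → ℂ) (z s : ℂ) : ℂ :=
  (paramPoly r n a z).resultant (dualPoly r n a s) (n + 1) (n + 1)

/-- The resultant is a power of the leading coefficient `r` times the product of `dualPoly` over the
roots of `paramPoly`. These roots are nonzero because the constant coefficient is `a n`; this needs
`1 ≤ n`, since otherwise `z` would enter it. -/
theorem eliminant_eq_zero_iff (hn : 1 ≤ n) (hr : 0 < r) (ha : a n ≠ 0) {z s : ℂ} :
    eliminant r n a z s = 0 ↔ IsAlgValue r n a z s := by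
  have h := Polynomial.resultant_eq_prod_eval (paramPoly r n a z) (dualPoly r n a s) (n + 1)
    (natDegree_dualPoly_le s) (IsAlgClosed.splits _)
  rw [natDegree_paramPoly hn hr] at h
  have h0 := paramPoly_ne_zero (a := a) hn hr z
  rw [eliminant, h, mul_eq_zero, or_iff_right (pow_ne_zero _ (by simpa using h0)),
    Multiset.prod_eq_zero_iff, Multiset.mem_map]
  constructor
  · rintro ⟨w, hw, hw'⟩
    rw [Polynomial.mem_roots h0, Polynomial.IsRoot.def] at hw
    have hw0 : w ≠ 0 := by
      rintro rfl
      exact ha (by rw [← hw, eval_zero_paramPoly hn])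
    rw [eval_paramPoly hw0, mul_eq_zero, or_iff_right (pow_ne_zero _ hw0), sub_eq_zero] at hw
    rw [eval_dualPoly hw0, mul_eq_zero, or_iff_right hw0, sub_eq_zero] at hw'
    exact ⟨w, hw0, hw, hw'⟩
  · rintro ⟨w, hw0, hw, hw'⟩
    refine ⟨w, ?_, ?_⟩
    · rw [Polynomial.mem_roots h0, Polynomial.IsRoot.def, eval_paramPoly hw0, hw]
      simp
    · rw [eval_dualPoly hw0, hw']
      simp

/-- The eliminant is a determinant whose entries are coefficients affine in `z` or in `g z`. -/
theorem analyticAt_eliminant {g : ℂ → ℂ} {q : ℂ} (hg : AnalyticAt ℂ g q) :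
    AnalyticAt ℂ (fun z => eliminant r n a z (g z)) q := by
  have h1 : ∀ k, AnalyticAt ℂ (fun z => (paramPoly r n a z).coeff k) q := fun k => by
    rw [funext fun z => coeff_paramPoly (r := r) (n := n) (a := a) z k]
    split_ifs <;> fun_prop
  have h2 : ∀ k, AnalyticAt ℂ (fun z => (dualPoly r n a (g z)).coeff k) q := fun k => by
    rw [funext fun z => coeff_dualPoly (r := r) (n := n) (a := a) (g z) k]
    split_ifs <;> fun_prop
  have h3 : ∀ i j, AnalyticAt ℂ (fun z => (Polynomial.sylvester (paramPoly r n a z)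
      (dualPoly r n a (g z)) (n + 1) (n + 1)) i j) q := by
    intro i j
    induction j using Fin.addCases with
    | left j =>
      simp only [Polynomial.sylvester, Matrix.of_apply, Fin.addCases_left]
      split_ifs
      · exact h2 _
      · exact analyticAt_const
    | right j =>
      simp only [Polynomial.sylvester, Matrix.of_apply, Fin.addCases_right]
      split_ifs
      · exact h1 _
      · exact analyticAt_const
  simp only [eliminant, Polynomial.resultant, Matrix.det_apply]
  refine Finset.analyticAt_fun_sum _ fun τ _ => ?_
  have := Finset.analyticAt_fun_prod (N := (Finset.univ : Finset (Fin (n + 1 + (n + 1)))))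
    (f := fun i z => (Polynomial.sylvester (paramPoly r n a z)
      (dualPoly r n a (g z)) (n + 1) (n + 1)) (τ i) i) (c := q) fun i _ => h3 _ _
  simp only [Units.smul_def, zsmul_eq_mul]
  exact analyticAt_const.mul this

/-- The germ of `g` at `q` is a branch of the algebraic function `T ∘ h⁻¹`. -/
def IsAlgGerm (r : ℝ) (n : ℕ) (a : ℕ → ℂ) (q : ℂ) (g : ℂ → ℂ) : Prop :=
  ∀ᶠ z in 𝓝 q, IsAlgValue r n a z (g z)

theorem IsAlgGerm.congr {q : ℂ} {g g' : ℂ → ℂ} (h : IsAlgGerm r n a q g) (hg : g =ᶠ[𝓝 q] g') :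
    IsAlgGerm r n a q g' := by
  filter_upwards [h, hg] with z h1 h2
  rwa [← h2]

/-- Being a branch of `T ∘ h⁻¹` persists under analytic continuation. -/
theorem GermSection.isAlgGerm {X : Type*} [TopologicalSpace X] [PreconnectedSpace X] {c : X → ℂ}
    {F : X → ℂ → ℂ} (hn : 1 ≤ n) (hr : 0 < r) (ha : a n ≠ 0) (hc : Continuous c)
    (hF : GermSection c F) {x₀ : X} (h₀ : IsAlgGerm r n a (c x₀) (F x₀)) (x : X) :
    IsAlgGerm r n a (c x) (F x) := by
  -- The eliminant along a section of germs is again a section, so its vanishing propagates by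
  -- uniqueness of continuation.
  have hE : GermSection c fun x z => eliminant r n a z (F x z) :=
    ⟨fun x => analyticAt_eliminant (hF.analyticAt x), fun x => by
      filter_upwards [hF.eventuallyEq x] with y hy
      filter_upwards [hy] with z hz
      rw [hz]⟩
  have h0 : GermSection c fun _ _ => 0 := GermSection.const fun _ => analyticAt_const
  have := hE.eventuallyEq_of_eventuallyEq hc h0 (x₀ := x₀)
    (h₀.mono fun z hz => (eliminant_eq_zero_iff hn hr ha).2 hz) x
  exact this.mono fun z hz => (eliminant_eq_zero_iff hn hr ha).1 hz

theorem ContinuesTo.isAlgGerm {x y : ℂ} {c : Path x y} {f g : ℂ → ℂ} (hn : 1 ≤ n) (hr : 0 < r)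
    (ha : a n ≠ 0) (h : ContinuesTo c f g) (hf : IsAlgGerm r n a x f) : IsAlgGerm r n a y g := by
  obtain ⟨F, hF, h0, h1⟩ := continuesTo_iff.1 h
  have := hF.isAlgGerm hn hr ha c.continuous (x₀ := 0) (by
    rw [c.source]; exact hf.congr h0.symm) 1
  rw [c.target] at this
  exact this.congr h1

/-! ### Critical values, properness of `h`, and local branches of `T ∘ h⁻¹`. -/

theorem exists_analytic_local_inverse {f : ℂ → ℂ} {w : ℂ} (hf : AnalyticAt ℂ f w)
    (hd : deriv f w ≠ 0) : ∃ φ : ℂ → ℂ, AnalyticAt ℂ φ (f w) ∧ φ (f w) = w ∧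
      (∀ᶠ z in 𝓝 (f w), f (φ z) = z) ∧ ∀ᶠ v in 𝓝 w, φ (f v) = v := by
  have hd' := hf.differentiableAt.hasDerivAt
  have hfd : HasFDerivAt f ((ContinuousLinearEquiv.unitsEquivAut ℂ (Units.mk0 _ hd) : ℂ ≃L[ℂ] ℂ) :
      ℂ →L[ℂ] ℂ) w := by
    have := hd'.hasFDerivAt
    convert! this using 1
  have hcd : ContDiffAt ℂ ⊤ f w := hf.contDiffAt
  refine ⟨hcd.localInverse hfd (by simp), (hcd.to_localInverse hfd (by simp)).analyticAt,
    hcd.localInverse_apply_image hfd (by simp), ?_, ?_⟩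
  · exact (hcd.hasStrictFDerivAt' hfd (by simp)).eventually_right_inverse
  · exact (hcd.hasStrictFDerivAt' hfd (by simp)).eventually_left_inverse

/-- The critical values of the Laurent polynomial on the punctured plane. -/
def criticalValues (r : ℝ) (n : ℕ) (a : ℕ → ℂ) : Set ℂ :=
  param r n a '' {w | w ≠ 0 ∧ deriv (param r n a) w = 0}

theorem finite_criticalValues (hr : 0 < r) : (criticalValues r n a).Finite := by
  refine Finite.image _ ?_
  -- This is `w ^ (n + 1) * h' w`, with leading coefficient `r`.
  let D : Polynomial ℂ := Polynomial.C (r : ℂ) * Polynomial.X ^ (n + 1) -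
    ∑ j ∈ Finset.range (n + 1), Polynomial.C (j * a j) * Polynomial.X ^ (n - j)
  have hD : D ≠ 0 := by
    intro h
    have h1 : D.coeff (n + 1) = r := by
      simp only [D, Polynomial.coeff_sub, Polynomial.finsetSum_coeff,
        Polynomial.coeff_C_mul, Polynomial.coeff_X_pow]
      rw [Finset.sum_eq_zero]
      · simp
      · intro j _
        rw [if_neg (by lia)]
        simp
    rw [h] at h1
    rw [Polynomial.coeff_zero] at h1
    exact hr.ne' (Complex.ofReal_eq_zero.1 h1.symm)
  refine (Polynomial.finite_setOfPred_isRoot hD).subset ?_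
  rintro w ⟨hw, hd⟩
  have hder : HasDerivAt (param r n a) ((r : ℂ) * 1 + ∑ j ∈ Finset.range (n + 1),
      a j * (-(j * w ^ (j - 1)) / (w ^ j) ^ 2)) w := by
    unfold param
    refine ((hasDerivAt_id w).const_mul _).add (HasDerivAt.fun_sum fun j _ => ?_)
    exact ((hasDerivAt_pow j w).fun_inv (pow_ne_zero _ hw)).const_mul _
  rw [hder.deriv] at hd
  simp only [mem_ofPred_eq, Polynomial.IsRoot.def, D, Polynomial.eval_sub, Polynomial.eval_mul,
    Polynomial.eval_C, Polynomial.eval_pow, Polynomial.eval_X, Polynomial.eval_finsetSum]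
  rw [← mul_zero (w ^ (n + 1)), ← hd, mul_add, Finset.mul_sum, sub_eq_add_neg,
    ← Finset.sum_neg_distrib]
  congr 1
  · ring
  · refine Finset.sum_congr rfl fun j hj => ?_
    rw [Finset.mem_range_succ_iff] at hj
    obtain ⟨k, rfl⟩ := Nat.exists_eq_add_of_le hj
    rcases j with _ | j
    · simp
    · have : w ^ (j + 1 + k + 1) = w ^ k * (w ^ (j + 1)) * w := by ring
      rw [this, Nat.add_sub_cancel_left, Nat.add_sub_cancel]
      field_simp
      ring

/-- The Laurent polynomial is a proper map on the punctured plane. -/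
theorem exists_norm_bounds_of_norm_param_le (hn : 1 ≤ n) (hr : 0 < r) (ha : a n ≠ 0) (M : ℝ) :
    ∃ δ > 0, ∃ B, ∀ w ≠ 0, ‖param r n a w‖ ≤ M → δ ≤ ‖w‖ ∧ ‖w‖ ≤ B := by
  have hup : ∃ B, ∀ w ≠ 0, ‖param r n a w‖ ≤ M → ‖w‖ ≤ B := by
    set A := ∑ j ∈ Finset.range (n + 1), ‖a j‖
    refine ⟨max 1 ((M + A) / r), fun w hw h => ?_⟩
    rcases le_total ‖w‖ 1 with h1 | h1
    · exact h1.trans (le_max_left _ _)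
    refine le_trans ?_ (le_max_right _ _)
    rw [le_div_iff₀ hr]
    have h2 : ‖∑ j ∈ Finset.range (n + 1), a j * (w ^ j)⁻¹‖ ≤ A := by
      refine norm_sum_le_of_le _ fun j _ => ?_
      rw [norm_mul, norm_inv, norm_pow]
      exact mul_le_of_le_one_right (norm_nonneg _) (inv_le_one_of_one_le₀ (one_le_pow₀ h1))
    have h3 : (r : ℂ) * w = param r n a w - ∑ j ∈ Finset.range (n + 1), a j * (w ^ j)⁻¹ := by
      simp [param]
    have h4 : ‖(r : ℂ) * w‖ ≤ M + A := h3 ▸ (norm_sub_le _ _).trans (add_le_add h h2)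
    rw [norm_mul, Complex.norm_real, Real.norm_of_nonneg hr.le] at h4
    linarith
  obtain ⟨B, hB⟩ := hup
  set A := ∑ j ∈ Finset.range n, ‖a j‖
  have hA : 0 ≤ A := Finset.sum_nonneg fun _ _ => norm_nonneg _
  have hK : 0 < r + A + |M| := by positivity
  refine ⟨min 1 (‖a n‖ / (r + A + |M|)), lt_min one_pos (div_pos (norm_pos_iff.2 ha) hK), B,
    fun w hw h => ⟨?_, hB w hw h⟩⟩
  rcases le_total 1 ‖w‖ with h1 | h1
  · exact (min_le_left _ _).trans h1
  refine (min_le_right _ _).trans ?_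
  rw [div_le_iff₀ hK]
  have hpow : ∀ k, 1 ≤ k → ‖w‖ ^ k ≤ ‖w‖ := fun k hk =>
    (pow_le_pow_of_le_one (norm_nonneg w) h1 hk).trans (pow_one _).le
  -- For `‖w‖ ≤ 1` every term on the right contains a positive power of `w`, so `‖a n‖` is at most a
  -- constant times `‖w‖`.
  have h2 : a n = w ^ n * param r n a w - (r : ℂ) * w ^ (n + 1) -
      ∑ j ∈ Finset.range n, a j * w ^ (n - j) := by
    have h3 := eval_paramPoly (r := r) (n := n) (a := a) hw 0
    simp only [paramPoly, Polynomial.eval_sub, Polynomial.eval_add, Polynomial.eval_mul,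
      Polynomial.eval_C, Polynomial.eval_pow, Polynomial.eval_X, Polynomial.eval_finsetSum,
      Finset.sum_range_succ, sub_zero, zero_mul, Nat.sub_self, pow_zero, mul_one] at h3
    rw [← h3]
    ring
  have h3 : ‖∑ j ∈ Finset.range n, a j * w ^ (n - j)‖ ≤ A * ‖w‖ := by
    rw [Finset.sum_mul]
    refine norm_sum_le_of_le _ fun j hj => ?_
    rw [norm_mul, norm_pow]
    rw [Finset.mem_range] at hj
    exact mul_le_mul_of_nonneg_left (hpow _ (by lia)) (norm_nonneg _)
  have h4 : ‖w ^ n * param r n a w‖ ≤ ‖w‖ * |M| := by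
    rw [norm_mul, norm_pow]
    exact mul_le_mul (hpow n hn) (h.trans (le_abs_self M)) (norm_nonneg _) (norm_nonneg _)
  have h5 : ‖(r : ℂ) * w ^ (n + 1)‖ ≤ r * ‖w‖ := by
    rw [norm_mul, norm_pow, Complex.norm_real, Real.norm_of_nonneg hr.le]
    exact mul_le_mul_of_nonneg_left (hpow _ (by lia)) hr.le
  calc ‖a n‖ ≤ ‖w‖ * |M| + r * ‖w‖ + A * ‖w‖ := by
        rw [h2]
        exact (norm_sub_le _ _).trans (add_le_add ((norm_sub_le _ _).trans (add_le_add h4 h5)) h3)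
    _ = ‖w‖ * (r + A + |M|) := by ring

/-- Properness confines the preimages to a compact annulus away from `0`, where `T` is bounded. This
makes isolated singularities of single-valued branches removable. -/
theorem exists_norm_le_of_isAlgValue (hn : 1 ≤ n) (hr : 0 < r) (ha : a n ≠ 0) (M : ℝ) :
    ∃ B, ∀ z s, ‖z‖ ≤ M → IsAlgValue r n a z s → ‖s‖ ≤ B := by
  obtain ⟨δ, hδ, R, hR⟩ := exists_norm_bounds_of_norm_param_le hn hr ha M
  have hc : IsCompact {w : ℂ | δ ≤ ‖w‖ ∧ ‖w‖ ≤ R} := by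
    refine (isCompact_closedBall (0 : ℂ) R).of_isClosed_subset
      ((isClosed_le continuous_const continuous_norm).inter
        (isClosed_le continuous_norm continuous_const)) fun w hw => ?_
    simpa using hw.2
  obtain ⟨B, hB⟩ := hc.exists_bound_of_continuousOn (f := dual r n a) fun w hw =>
    (analyticAt_dual (norm_pos_iff.1 (hδ.trans_le hw.1))).continuousAt.continuousWithinAt
  refine ⟨B, ?_⟩
  rintro z s hz ⟨w, hw, rfl, rfl⟩
  exact hB w (hR w hw hz)

/-- Near a noncritical value, the preimages are given by finitely many local inverses. -/
theorem exists_local_inverses (hn : 1 ≤ n) (hr : 0 < r) (ha : a n ≠ 0) {p : ℂ}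
    (hp : p ∉ criticalValues r n a) : ∃ ε > 0, ∃ (Z : Finset ℂ) (φ : ℂ → ℂ → ℂ),
      (∀ w ∈ Z, ∀ z ∈ ball p ε, AnalyticAt ℂ (φ w) z ∧ φ w z ≠ 0 ∧ param r n a (φ w z) = z) ∧
      ∀ v ≠ 0, param r n a v ∈ ball p ε → ∃ w ∈ Z, v = φ w (param r n a v) := by
  have hfin : {w : ℂ | w ≠ 0 ∧ param r n a w = p}.Finite := by
    refine (Polynomial.finite_setOfPred_isRoot (paramPoly_ne_zero (a := a) hn hr p)).subset ?_
    rintro w ⟨hw, hd⟩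
    rw [mem_ofPred_eq, Polynomial.IsRoot.def, eval_paramPoly hw, hd, sub_self, mul_zero]
  have hloc : ∀ w ∈ {w : ℂ | w ≠ 0 ∧ param r n a w = p}, ∃ φ : ℂ → ℂ,
      (∀ᶠ z in 𝓝 p, AnalyticAt ℂ φ z ∧ φ z ≠ 0 ∧ param r n a (φ z) = z) ∧
      ∀ᶠ v in 𝓝 w, φ (param r n a v) = v := by
    rintro w ⟨hw, rfl⟩
    obtain ⟨φ, h1, h2, h3, h4⟩ := exists_analytic_local_inverse (analyticAt_param hw)
      (fun h => hp ⟨w, ⟨hw, h⟩, rfl⟩)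
    refine ⟨φ, ?_, h4⟩
    exact h1.eventually_analyticAt.and
      ((h1.continuousAt.eventually_ne (by rwa [h2])).and h3)
  choose! φ hφ hφ' using hloc
  have hU : ∀ w ∈ {w : ℂ | w ≠ 0 ∧ param r n a w = p}, ∃ U : Set ℂ, IsOpen U ∧ w ∈ U ∧
      ∀ v ∈ U, φ w (param r n a v) = v := fun w hw => by
    obtain ⟨U, h1, h2, h3⟩ := _root_.eventually_nhds_iff.1 (hφ' w hw)
    exact ⟨U, h2, h3, h1⟩
  choose! U hUo hwU hU using hU
  obtain ⟨δ, hδ, R, hR⟩ := exists_norm_bounds_of_norm_param_le hn hr ha (‖p‖ + 1)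
  -- `K` holds the possible preimages that no local inverse accounts for. Its image is closed and
  -- misses `p`, so values near `p` have no preimage in `K`.
  set K : Set ℂ := {w : ℂ | δ ≤ ‖w‖ ∧ ‖w‖ ≤ R} \
    ⋃ w ∈ {w : ℂ | w ≠ 0 ∧ param r n a w = p}, U w with hK
  have hKc : IsCompact K := by
    refine (isCompact_closedBall (0 : ℂ) R).of_isClosed_subset
      (((isClosed_le continuous_const continuous_norm).inter
        (isClosed_le continuous_norm continuous_const)).sdiff (isOpen_biUnion hUo)) fun w hw => ?_
    simpa using hw.1.2
  have hKi : IsClosed (param r n a '' K) := (hKc.image_of_continuousOn fun w hw =>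
    (analyticAt_param
      (norm_pos_iff.1 (hδ.trans_le hw.1.1))).continuousAt.continuousWithinAt).isClosed
  have hpK : p ∉ param r n a '' K := by
    rintro ⟨w, hw, hwp⟩
    have hm : w ∈ {w : ℂ | w ≠ 0 ∧ param r n a w = p} :=
      ⟨norm_pos_iff.1 (hδ.trans_le hw.1.1), hwp⟩
    exact hw.2 (mem_biUnion hm (hwU w hm))
  have hev : ∀ᶠ z in 𝓝 p, ‖z‖ ≤ ‖p‖ + 1 ∧ z ∉ param r n a '' K ∧
      ∀ w ∈ hfin.toFinset, AnalyticAt ℂ (φ w) z ∧ φ w z ≠ 0 ∧ param r n a (φ w z) = z := by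
    refine ((continuous_norm.continuousAt.eventually (eventually_lt_nhds (lt_add_one _))).mono
      fun z hz => le_of_lt hz).and ((hKi.isOpen_compl.eventually_mem hpK).and ?_)
    rw [Finset.eventually_all]
    exact fun w hw => hφ w (hfin.mem_toFinset.1 hw)
  obtain ⟨ε, hε, h⟩ := Metric.eventually_nhds_iff_ball.1 hev
  refine ⟨ε, hε, hfin.toFinset, φ, fun w hw z hz => (h z hz).2.2 w hw, fun v hv hvp => ?_⟩
  have h1 := hR v hv (h _ hvp).1
  by_contra! hcon
  refine (h _ hvp).2.1 ⟨v, ⟨h1, fun hv2 => ?_⟩, rfl⟩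
  obtain ⟨w, hw, hvw⟩ := mem_iUnion₂.1 hv2
  exact hcon w (hfin.mem_toFinset.2 hw) (hU w hw v hvw).symm

/-- Near a noncritical value, the branches of `T ∘ h⁻¹` extend to a common disc. -/
theorem exists_extension_of_notMem_criticalValues (hn : 1 ≤ n) (hr : 0 < r) (ha : a n ≠ 0) {p : ℂ}
    (hp : p ∉ criticalValues r n a) : ∃ ε > 0, ∀ q ∈ ball p ε, ∀ g, AnalyticAt ℂ g q →
      IsAlgGerm r n a q g → ∃ G, AnalyticOnNhd ℂ G (ball p ε) ∧ G =ᶠ[𝓝 q] g ∧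
        ∀ z ∈ ball p ε, IsAlgValue r n a z (G z) := by
  obtain ⟨ε, hε, Z, φ, h1, h2⟩ := exists_local_inverses hn hr ha hp
  have han : ∀ w ∈ Z, AnalyticOnNhd ℂ (fun z => dual r n a (φ w z)) (ball p ε) := fun w hw z hz =>
    (analyticAt_dual (h1 w hw z hz).2.1).comp (h1 w hw z hz).1
  refine ⟨ε, hε, fun q hq g hga hg => ?_⟩
  -- Otherwise `g` would differ from each of the finitely many local branches throughout a punctured
  -- neighbourhood of `q`, although each of its values is taken by one of them.
  have hfr : ∃ w ∈ Z, (fun z => dual r n a (φ w z)) =ᶠ[𝓝 q] g := by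
    by_contra! hcon
    have hne : ∀ᶠ z in 𝓝[≠] q, ∀ w ∈ Z, dual r n a (φ w z) ≠ g z := by
      rw [Finset.eventually_all]
      exact fun w hw => ((han w hw q hq).eventually_eq_or_eventually_ne hga).resolve_left
        (hcon w hw)
    obtain ⟨z, hz1, hz2, hz3⟩ := (hne.and ((hg.and (isOpen_ball.eventually_mem hq)).filter_mono
      nhdsWithin_le_nhds)).exists
    obtain ⟨v, hv, rfl, hv'⟩ := hz2
    obtain ⟨w, hw, hvw⟩ := h2 v hv hz3
    exact hz1 w hw (by rw [← hvw, hv'])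
  obtain ⟨w, hw, hwg⟩ := hfr
  exact ⟨_, han w hw, hwg, fun z hz => ⟨φ w z, (h1 w hw z hz).2.1, (h1 w hw z hz).2.2, rfl⟩⟩

end

section

/-! ### Continuation in a punctured disc -/

/-- A map of the plane onto the punctured disc `ball p ε \ {p}` that is, up to a homeomorphism, the
exponential map. -/
def discCover (p : ℂ) (ε : ℝ) (ζ : ℂ) : ℂ :=
  p + ε * (Complex.exp ζ / (1 + ‖Complex.exp ζ‖ : ℝ))

variable {p q : ℂ} {ε : ℝ}

theorem continuous_discCover : Continuous (discCover p ε) := by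
  unfold discCover
  have : ∀ ζ, ((1 + ‖Complex.exp ζ‖ : ℝ) : ℂ) ≠ 0 := fun ζ => by
    rw [Complex.ofReal_ne_zero]
    positivity
  fun_prop (disch := exact this _)

theorem norm_discCover_sub (hε : 0 < ε) (ζ : ℂ) :
    ‖discCover p ε ζ - p‖ = ε * (‖Complex.exp ζ‖ / (1 + ‖Complex.exp ζ‖)) := by
  rw [discCover, add_sub_cancel_left, norm_mul, norm_div, Complex.norm_real, Complex.norm_real,
    Real.norm_of_nonneg hε.le, Real.norm_of_nonneg (by positivity)]

theorem discCover_mem (hε : 0 < ε) (ζ : ℂ) : discCover p ε ζ ∈ ball p ε \ {p} := by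
  have h := norm_discCover_sub (p := p) hε ζ
  have h0 : 0 < ‖Complex.exp ζ‖ := norm_pos_iff.2 (Complex.exp_ne_zero ζ)
  constructor
  · rw [mem_ball, dist_eq_norm, h]
    have : ‖Complex.exp ζ‖ / (1 + ‖Complex.exp ζ‖) < 1 := by
      rw [div_lt_one (by positivity)]
      linarith
    exact mul_lt_of_lt_one_right hε this
  · rw [mem_singleton_iff, ← sub_eq_zero, ← norm_eq_zero, h]
    positivity

theorem discCover_add_two_pi_I (ζ : ℂ) :
    discCover p ε (ζ + 2 * Real.pi * Complex.I) = discCover p ε ζ := by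
  rw [discCover, discCover, Complex.exp_periodic]

/-- The coordinate on the disc that corresponds to the exponential under `discCover`. -/
def discCoord (p : ℂ) (ε : ℝ) (z : ℂ) : ℂ := (z - p) / (ε - ‖z - p‖ : ℝ)

theorem discCover_of_exp_eq (hε : 0 < ε) {z ζ : ℂ} (hz : z ∈ ball p ε)
    (h : Complex.exp ζ = discCoord p ε z) : discCover p ε ζ = z := by
  have hz' : 0 < ε - ‖z - p‖ := by rw [mem_ball, dist_eq_norm] at hz; linarith
  have h1 : 1 + ‖discCoord p ε z‖ = ε / (ε - ‖z - p‖) := by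
    rw [discCoord, norm_div, Complex.norm_real, Real.norm_of_nonneg hz'.le]
    field_simp
    ring
  have h2 : ((ε - ‖z - p‖ : ℝ) : ℂ) ≠ 0 := Complex.ofReal_ne_zero.2 hz'.ne'
  have h3 : (ε : ℂ) ≠ 0 := Complex.ofReal_ne_zero.2 hε.ne'
  rw [discCover, h, h1, discCoord, Complex.ofReal_div]
  field_simp
  ring

theorem discCoord_discCover (hε : 0 < ε) (ζ : ℂ) :
    discCoord p ε (discCover p ε ζ) = Complex.exp ζ := by
  have h0 : (0 : ℝ) < 1 + ‖Complex.exp ζ‖ := by positivity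
  have h1 : ε - ‖discCover p ε ζ - p‖ = ε / (1 + ‖Complex.exp ζ‖) := by
    rw [norm_discCover_sub hε]
    field_simp
    ring
  have h2 : ((1 + ‖Complex.exp ζ‖ : ℝ) : ℂ) ≠ 0 := Complex.ofReal_ne_zero.2 h0.ne'
  have h3 : (ε : ℂ) ≠ 0 := Complex.ofReal_ne_zero.2 hε.ne'
  rw [discCoord, h1, discCover, Complex.ofReal_div, add_sub_cancel_left]
  field_simp

theorem discCoord_ne_zero {z : ℂ} (hz : z ∈ ball p ε \ {p}) : discCoord p ε z ≠ 0 := by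
  have hz' : ε - ‖z - p‖ ≠ 0 := by
    have := hz.1
    rw [mem_ball, dist_eq_norm] at this
    linarith
  exact div_ne_zero (sub_ne_zero.2 hz.2) (Complex.ofReal_ne_zero.2 hz')

theorem continuousAt_discCoord {z : ℂ} (hz : z ∈ ball p ε) :
    ContinuousAt (discCoord p ε) z := by
  have hz' : ε - ‖z - p‖ ≠ 0 := by
    rw [mem_ball, dist_eq_norm] at hz
    linarith
  unfold discCoord
  have : ((ε - ‖z - p‖ : ℝ) : ℂ) ≠ 0 := Complex.ofReal_ne_zero.2 hz'
  fun_prop (disch := exact this)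

theorem exists_discCover_eq (hε : 0 < ε) {z : ℂ} (hz : z ∈ ball p ε \ {p}) :
    ∃ ζ, discCover p ε ζ = z :=
  ⟨Complex.log (discCoord p ε z),
    discCover_of_exp_eq hε hz.1 (Complex.exp_log (discCoord_ne_zero hz))⟩

/-- A periodic section over the universal cover of the punctured disc descends. -/
theorem GermSection.exists_analyticOnNhd_of_periodic {F : ℂ → ℂ → ℂ} (hε : 0 < ε)
    (hF : GermSection (discCover p ε) F) {ζ₁ : ℂ}
    (hper : F (ζ₁ + 2 * Real.pi * Complex.I) =ᶠ[𝓝 (discCover p ε ζ₁)] F ζ₁) :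
    ∃ G, AnalyticOnNhd ℂ G (ball p ε \ {p}) ∧ ∀ ζ, G =ᶠ[𝓝 (discCover p ε ζ)] F ζ := by
  have h1 : ∀ ζ, F (ζ + 2 * Real.pi * Complex.I) =ᶠ[𝓝 (discCover p ε ζ)] F ζ := by
    have := hF.comp (k := fun ζ => ζ + 2 * Real.pi * Complex.I) (by fun_prop)
    rw [show discCover p ε ∘ (fun ζ => ζ + 2 * Real.pi * Complex.I) = discCover p ε from
      funext discCover_add_two_pi_I] at this
    exact this.eventuallyEq_of_eventuallyEq continuous_discCover hF hper
  have h2 : ∀ (k : ℕ) ζ, discCover p ε (ζ + k * (2 * Real.pi * Complex.I)) = discCover p ε ζ ∧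
      F (ζ + k * (2 * Real.pi * Complex.I)) =ᶠ[𝓝 (discCover p ε ζ)] F ζ := by
    intro k ζ
    induction k with
    | zero => simp
    | succ k ih =>
      have h3 : ζ + ((k + 1 : ℕ) : ℂ) * (2 * Real.pi * Complex.I) =
          ζ + k * (2 * Real.pi * Complex.I) + 2 * Real.pi * Complex.I := by push_cast; ring
      rw [h3, discCover_add_two_pi_I]
      have h4 := h1 (ζ + k * (2 * Real.pi * Complex.I))
      rw [ih.1] at h4
      exact ⟨ih.1, h4.trans ih.2⟩
  have h3 : ∀ ζ ζ', Complex.exp ζ = Complex.exp ζ' → F ζ =ᶠ[𝓝 (discCover p ε ζ)] F ζ' := by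
    intro ζ ζ' h
    obtain ⟨k, hk⟩ := Complex.exp_eq_exp_iff_exists_int.1 h
    have hr : discCover p ε ζ = discCover p ε ζ' := by rw [discCover, discCover, h]
    obtain ⟨m, rfl | rfl⟩ := k.eq_nat_or_neg
    · rw [hr, hk]
      exact_mod_cast (h2 m ζ').2
    · have : ζ' = ζ + m * (2 * Real.pi * Complex.I) := by
        rw [hk]; push_cast; ring
      rw [this]
      exact (h2 m ζ).2.symm
  have key : ∀ ζ, (fun z => F (Complex.log (discCoord p ε z)) z) =ᶠ[𝓝 (discCover p ε ζ)] F ζ := by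
    intro ζ
    set z₀ := discCover p ε ζ with hz₀
    have hmem := discCover_mem (p := p) hε ζ
    -- A lift continuous near `z₀` with value `ζ` there. The principal logarithm may jump, but both
    -- lifts have the same exponential, so by periodicity they carry the same germ.
    set ℓ : ℂ → ℂ := fun z => ζ + Complex.log (discCoord p ε z / Complex.exp ζ) with hℓ
    have hz1 : discCoord p ε z₀ / Complex.exp ζ = 1 := by
      rw [discCoord_discCover hε, div_self (Complex.exp_ne_zero ζ)]
    have hℓ0 : ℓ z₀ = ζ := by simp [hℓ, hz1]
    have hℓc : ContinuousAt ℓ z₀ := by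
      have h5 : ContinuousAt (fun z => discCoord p ε z / Complex.exp ζ) z₀ :=
        (continuousAt_discCoord hmem.1).div_const _
      exact continuousAt_const.add (h5.clog (by rw [hz1]; simp))
    have h6 := hℓc.eventually (hℓ0.symm ▸ hF.eventuallyEq ζ)
    have h7 : ∀ᶠ z in 𝓝 z₀, z ∈ ball p ε \ {p} :=
      (isOpen_ball.sdiff isClosed_singleton).eventually_mem hmem
    filter_upwards [h6, h7] with z hz hz2
    have h8 : Complex.exp (ℓ z) = discCoord p ε z := by
      rw [hℓ]
      simp only
      rw [Complex.exp_add, Complex.exp_log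
        (div_ne_zero (discCoord_ne_zero hz2) (Complex.exp_ne_zero _)),
        mul_div_cancel₀ _ (Complex.exp_ne_zero _)]
    have h9 := h3 (Complex.log (discCoord p ε z)) (ℓ z)
      (by rw [h8, Complex.exp_log (discCoord_ne_zero hz2)])
    rw [discCover_of_exp_eq hε hz2.1 (Complex.exp_log (discCoord_ne_zero hz2))] at h9
    rw [discCover_of_exp_eq hε hz2.1 h8, hℓ0] at hz
    exact (h9.trans hz).eq_of_nhds
  refine ⟨_, fun z hz => ?_, key⟩
  obtain ⟨ζ, rfl⟩ := exists_discCover_eq hε hz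
  exact (hF.analyticAt ζ).congr (key ζ).symm

/-- A germ that continues along every path in the punctured disc gives a section over the universal
cover of the punctured disc. -/
theorem exists_germSection_discCover (hε : 0 < ε) (hq : q ∈ ball p ε \ {p}) {g : ℂ → ℂ}
    (hg : ∀ (y : ℂ) (c : Path q y), (∀ t, c t ∈ ball p ε \ {p}) → ∃ g', ContinuesTo c g g') :
    ∃ F, GermSection (discCover p ε) F ∧ ∃ ζ₀, discCover p ε ζ₀ = q ∧ F ζ₀ =ᶠ[𝓝 q] g := by
  obtain ⟨ζ₀, rfl⟩ := exists_discCover_eq hε hq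
  obtain ⟨F, hF, hF0⟩ := exists_germSection_of_segmentPath
    (continuous_discCover (p := p) (ε := ε)) (x₀ := ζ₀) (f := g)
    fun x => hg _ _ fun t => discCover_mem hε _
  exact ⟨F, hF, ζ₀, rfl, hF0⟩

/-- A germ that extends analytically to the punctured disc does not branch in it. -/
theorem not_branchesAround_of_analyticOnNhd {g G : ℂ → ℂ}
    (hG : AnalyticOnNhd ℂ G (ball p ε \ {p})) (h : G =ᶠ[𝓝 q] g) : ¬ BranchesAround g q p ε := by
  rintro ⟨-, l, g', hl, hc, hne⟩
  have h1 : ContinuesTo l g G :=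
    (ContinuesTo.of_analyticAt fun t => hG _ (hl t)).congr_left h
  exact hne ((hc.unique h1).trans h)

variable {r : ℝ} {n : ℕ} {a : ℕ → ℂ}

theorem IsAlgGerm.of_analyticOnNhd {G : ℂ → ℂ} {s : Set ℂ} (hn : 1 ≤ n) (hr : 0 < r)
    (ha : a n ≠ 0) (hs : IsPreconnected s) (hG : AnalyticOnNhd ℂ G s) (hq : q ∈ s)
    (h : IsAlgGerm r n a q G) {z : ℂ} (hz : z ∈ s) : IsAlgGerm r n a z G := by
  have := isPreconnected_iff_preconnectedSpace.1 hs
  have h1 : GermSection (Subtype.val : s → ℂ) fun _ => G := GermSection.const fun x => hG x x.2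
  exact h1.isAlgGerm hn hr ha continuous_subtype_val (x₀ := ⟨q, hq⟩) h ⟨z, hz⟩

/-- The branches of `T ∘ h⁻¹` do not branch around noncritical values of `h`. -/
theorem not_branchesAround_of_notMem_criticalValues (hn : 1 ≤ n) (hr : 0 < r) (ha : a n ≠ 0)
    (hε : 0 < ε) (hp : p ∉ criticalValues r n a) (hq : q ∈ ball p ε \ {p}) {g : ℂ → ℂ}
    (hg : IsAlgGerm r n a q g) : ¬ BranchesAround g q p ε := by
  intro hb
  obtain ⟨F, hF, ζ₀, rfl, hF0⟩ := exists_germSection_discCover hε hq hb.1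
  obtain ⟨δ, hδ, hext⟩ := exists_extension_of_notMem_criticalValues hn hr ha hp
  have halg := hF.isAlgGerm hn hr ha continuous_discCover (x₀ := ζ₀) (hg.congr hF0.symm)
  -- This vertical line covers a circle about `p` of radius at most `δ / 2`, inside the disc to
  -- which branches extend. Continuation along it stays single-valued, so the section is periodic.
  have hsmall : ∀ t : ℝ, discCover p ε (Real.log (δ / (2 * ε)) + t * Complex.I) ∈ ball p δ := by
    intro t
    rw [mem_ball, dist_eq_norm, norm_discCover_sub hε, Complex.norm_exp]
    simp only [Complex.add_re, Complex.ofReal_re, Complex.mul_re, Complex.I_re, Complex.I_im,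
      Complex.ofReal_im, mul_zero, zero_mul, sub_zero, add_zero]
    rw [Real.exp_log (by positivity)]
    have : δ / (2 * ε) / (1 + δ / (2 * ε)) ≤ δ / (2 * ε) :=
      div_le_self (by positivity) (by simp; positivity)
    calc ε * (δ / (2 * ε) / (1 + δ / (2 * ε))) ≤ ε * (δ / (2 * ε)) := by gcongr
      _ = δ / 2 := by field_simp
      _ < δ := half_lt_self hδ
  set k : ℝ → ℂ := fun t => Real.log (δ / (2 * ε)) + t * Complex.I with hk
  have hkc : Continuous k := by fun_prop
  obtain ⟨G, hG, hGF, -⟩ := hext _ (hsmall 0) _ (hF.analyticAt (k 0)) (halg (k 0))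
  have h1 := (hF.comp hkc).eventuallyEq_of_eventuallyEq (continuous_discCover.comp hkc)
    (GermSection.const (g := G) fun t => hG _ (hsmall t)) (x₀ := 0) hGF.symm (2 * Real.pi)
  have h2 : k (2 * Real.pi) = k 0 + 2 * Real.pi * Complex.I := by simp [hk]
  simp only [Function.comp_apply, h2] at h1
  rw [discCover_add_two_pi_I] at h1
  obtain ⟨G', hG', hGF'⟩ := hF.exists_analyticOnNhd_of_periodic hε (h1.trans hGF)
  exact not_branchesAround_of_analyticOnNhd hG' ((hGF' ζ₀).trans hF0) hb

/-- If a branch of `T ∘ h⁻¹` does not branch around the only critical value that a disc may contain,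
its centre, then it extends to the disc. -/
theorem exists_extension_of_not_branchesAround (hn : 1 ≤ n) (hr : 0 < r) (ha : a n ≠ 0)
    (hε : 0 < ε) (hp : ball p ε ∩ criticalValues r n a ⊆ {p}) (hq : q ∈ ball p ε \ {p})
    {g : ℂ → ℂ} (hga : AnalyticAt ℂ g q) (hg : IsAlgGerm r n a q g)
    (hb : ¬ BranchesAround g q p ε) : ∃ G, AnalyticOnNhd ℂ G (ball p ε) ∧ G =ᶠ[𝓝 q] g := by
  have hcont : ∀ (y : ℂ) (c : Path q y), (∀ t, c t ∈ ball p ε \ {p}) →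
      ∃ g', ContinuesTo c g g' := by
    intro y c hc
    refine exists_continuesTo_of_forall_ball (P := fun q g => AnalyticAt ℂ g q ∧ IsAlgGerm r n a q g)
      (fun p' hp' => ?_) c hc hga ⟨hga, hg⟩
    obtain ⟨δ, hδ, h⟩ := exists_extension_of_notMem_criticalValues hn hr ha
      (fun h => hp'.2 (hp ⟨hp'.1, h⟩))
    refine ⟨δ, hδ, fun q' hq' g' hg' => ?_⟩
    obtain ⟨G, hG, hGg, hGa⟩ := h q' hq'.1 g' hg'.1 hg'.2
    exact ⟨G, hG, hGg, fun z hz => ⟨hG z hz.1,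
      (isOpen_ball.eventually_mem hz.1).mono fun z' hz' => hGa z' hz'⟩⟩
  have hloop : ∀ (l : Path q q) (g' : ℂ → ℂ), (∀ t, l t ∈ ball p ε \ {p}) → ContinuesTo l g g' →
      g' =ᶠ[𝓝 q] g := by
    intro l g' hl hc
    by_contra hne
    exact hb ⟨hcont, l, g', hl, hc, hne⟩
  obtain ⟨F, hF, ζ₀, rfl, hF0⟩ := exists_germSection_discCover hε hq hcont
  have halg := hF.isAlgGerm hn hr ha continuous_discCover (x₀ := ζ₀) (hg.congr hF0.symm)
  -- The segment to `ζ₀ + 2πi` projects to a loop around `p`. The absence of branching along it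
  -- gives the period.
  have hper := hloop ((segmentPath continuous_discCover ζ₀ (ζ₀ + 2 * Real.pi * Complex.I)).cast rfl
    (discCover_add_two_pi_I ζ₀).symm) (F (ζ₀ + 2 * Real.pi * Complex.I))
    (fun t => discCover_mem hε _) (continuesTo_iff.2
      ⟨_, hF.comp (k := fun t : I => ζ₀ + (t : ℝ) * (ζ₀ + 2 * Real.pi * Complex.I - ζ₀))
        (by fun_prop), by simpa using hF0, by simp⟩)
  obtain ⟨G, hG, hGF⟩ := hF.exists_analyticOnNhd_of_periodic hε (hper.trans hF0.symm)
  obtain ⟨B, hB⟩ := exists_norm_le_of_isAlgValue hn hr ha (‖p‖ + ε)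
  have hbd : BddAbove (norm ∘ G '' (ball p ε \ {p})) := by
    refine ⟨B, ?_⟩
    rintro _ ⟨z, hz, rfl⟩
    refine hB z _ ?_ ?_
    · have h1 := hz.1
      rw [mem_ball, dist_eq_norm] at h1
      linarith [norm_le_norm_add_norm_sub' z p]
    · obtain ⟨ζ, rfl⟩ := exists_discCover_eq hε hz
      exact ((halg ζ).congr (hGF ζ).symm).self_of_nhds
  -- Riemann's removable singularity theorem at `p`.
  refine ⟨Function.update G p (limUnder (𝓝[≠] p) G),
    (Complex.differentiableOn_update_limUnder_of_bddAbove (ball_mem_nhds p hε)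
      hG.differentiableOn hbd).analyticOnNhd isOpen_ball, ?_⟩
  refine EventuallyEq.trans ?_ ((hGF ζ₀).trans hF0)
  filter_upwards [isOpen_compl_singleton.eventually_mem hq.2] with z hz
  exact Function.update_of_ne hz _ _

/-! ### Germs accessible from the curve -/

/-- The germ of `g` at `q` is a branch of `T ∘ h⁻¹` that arises from `S` by continuation along a path
from `γ` to `q`, in `G` after its starting point. -/
structure IsAccessible (r : ℝ) (n : ℕ) (a : ℕ → ℂ) (S : ℂ → ℂ) (γ G : Set ℂ) (q : ℂ)
    (g : ℂ → ℂ) : Prop where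
  isAlgGerm : IsAlgGerm r n a q g
  exists_path : ∃ z ∈ γ, ∃ c : Path z q, (∀ t : I, 0 < t → c t ∈ G) ∧ ContinuesTo c S g

variable {S g : ℂ → ℂ} {γ D : Set ℂ}

theorem IsAccessible.analyticAt (h : IsAccessible r n a S γ D q g) : AnalyticAt ℂ g q := by
  obtain ⟨z, -, c, -, hc⟩ := h.exists_path
  exact hc.analyticAt

theorem IsAccessible.of_mem_ball (hn : 1 ≤ n) (hr : 0 < r) (ha : a n ≠ 0)
    (h : IsAccessible r n a S γ D q g) {G : ℂ → ℂ} (hD : ball p ε ⊆ D)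
    (hG : AnalyticOnNhd ℂ G (ball p ε)) (hGg : G =ᶠ[𝓝 q] g) (hq : q ∈ ball p ε) {q' : ℂ}
    (hq' : q' ∈ ball p ε) : IsAccessible r n a S γ D q' G := by
  refine ⟨IsAlgGerm.of_analyticOnNhd hn hr ha (convex_ball p ε).isPreconnected hG hq
    (h.isAlgGerm.congr hGg.symm) hq', ?_⟩
  obtain ⟨z, hz, c, hc, hcg⟩ := h.exists_path
  let d : Path q q' := segmentPath (r := fun x => x) continuous_id q q'
  have hd : ∀ t, d t ∈ ball p ε := fun t => by
    have := (convex_ball p ε).add_smul_sub_mem hq hq' t.2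
    simpa [d, segmentPath_apply] using this
  refine ⟨z, hz, c.trans d, fun t ht => ?_,
    hcg.trans ((ContinuesTo.of_analyticAt fun t => hG _ (hd t)).congr_left hGg)⟩
  rw [Path.trans_apply]
  split_ifs with h1
  · refine hc _ ?_
    rw [← Subtype.coe_lt_coe]
    have : (0 : ℝ) < t := ht
    simpa using this
  · exact hD (hd _)

/-- In the absence of branch points, accessible germs extend to discs of a size depending only on
the centre. -/
theorem IsAccessible.exists_extension (hn : 1 ≤ n) (hr : 0 < r) (ha : a n ≠ 0) (hD : IsOpen D)
    (hp : p ∈ D) (hb : ¬ IsBranchPoint S γ D p) : ∃ ε > 0, ∀ q ∈ ball p ε ∩ D, ∀ g,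
      IsAccessible r n a S γ D q g → ∃ G, AnalyticOnNhd ℂ G (ball p ε) ∧ G =ᶠ[𝓝 q] g ∧
        ∀ q' ∈ ball p ε ∩ D, IsAccessible r n a S γ D q' G := by
  have hC : IsClosed (criticalValues r n a \ {p}) :=
    ((finite_criticalValues hr).subset sdiff_subset).isClosed
  obtain ⟨ε, hε, h⟩ := Metric.mem_nhds_iff.1
    (inter_mem (hD.mem_nhds hp) (hC.isOpen_compl.mem_nhds fun h => h.2 rfl))
  have hεD : ball p ε ⊆ D := h.trans inter_subset_left
  have hεC : ball p ε ∩ criticalValues r n a ⊆ {p} := fun z hz => by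
    by_contra hzp
    exact (h hz.1).2 ⟨hz.2, hzp⟩
  have key : ∀ q ∈ ball p ε \ {p}, ∀ g, IsAccessible r n a S γ D q g →
      ∃ G, AnalyticOnNhd ℂ G (ball p ε) ∧ G =ᶠ[𝓝 q] g := by
    intro q hq g hg
    refine exists_extension_of_not_branchesAround hn hr ha hε hεC hq hg.analyticAt hg.isAlgGerm
      fun hbr => hb ?_
    obtain ⟨z, hz, c, hc, hcg⟩ := hg.exists_path
    exact ⟨ε, hε, hεD, z, hz, q, hq, c, g, hc, hcg, hbr⟩
  refine ⟨ε, hε, fun q hq g hg => ?_⟩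
  suffices ∃ G, AnalyticOnNhd ℂ G (ball p ε) ∧ G =ᶠ[𝓝 q] g by
    obtain ⟨G, hG, hGg⟩ := this
    exact ⟨G, hG, hGg, fun q' hq' => hg.of_mem_ball hn hr ha hεD hG hGg hq.1 hq'.1⟩
  -- A germ at the centre itself is first moved to a nearby point, where `key` applies; the identity
  -- theorem then brings the extension back.
  rcases eq_or_ne q p with rfl | hqp
  · obtain ⟨ρ, hρ, hρa⟩ := Metric.eventually_nhds_iff_ball.1 hg.analyticAt.eventually_analyticAt
    have hm : 0 < min ρ ε := lt_min hρ hε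
    have h1 : AnalyticOnNhd ℂ g (ball q (min ρ ε)) := fun z hz =>
      hρa z (ball_subset_ball (min_le_left _ _) hz)
    have h2 : q + (min ρ ε / 2 : ℝ) ∈ ball q (min ρ ε) := by
      rw [mem_ball, dist_eq_norm, add_sub_cancel_left, Complex.norm_real,
        Real.norm_of_nonneg (by positivity)]
      exact half_lt_self hm
    have h3 : q + (min ρ ε / 2 : ℝ) ≠ q := by
      rw [Ne, add_eq_left, Complex.ofReal_eq_zero]
      positivity
    have hsub : ball q (min ρ ε) ⊆ ball q ε := ball_subset_ball (min_le_right _ _)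
    obtain ⟨G, hG, hGg⟩ := key _ ⟨hsub h2, h3⟩ g (hg.of_mem_ball hn hr ha (hsub.trans hεD) h1
      EventuallyEq.rfl (mem_ball_self hm) h2)
    refine ⟨G, hG, ?_⟩
    exact (AnalyticOnNhd.eqOn_of_preconnected_of_eventuallyEq (hG.mono hsub) h1
      (convex_ball _ _).isPreconnected h2 hGg).eventuallyEq_of_mem (ball_mem_nhds _ hm)
  · exact key q ⟨hq.1, hqp⟩ g hg

end

section

/-! ### Winding numbers on the unit circle -/

/-- On the unit circle, `f` is `w ^ m` times the exponential of a continuous function: its winding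
number around `0` is `m`. -/
def HasWinding (f : ℂ → ℂ) (m : ℤ) : Prop :=
  ∃ u : ℂ → ℂ, ContinuousOn u (sphere 0 1) ∧ ∀ w ∈ sphere (0 : ℂ) 1, f w = w ^ m * Complex.exp (u w)

theorem ne_zero_of_mem_sphere {w : ℂ} (hw : w ∈ sphere (0 : ℂ) 1) : w ≠ 0 :=
  ne_zero_of_mem_unit_sphere ⟨w, hw⟩

namespace HasWinding

variable {f g : ℂ → ℂ} {m k : ℤ}

theorem congr (hf : HasWinding f m) (h : EqOn f g (sphere 0 1)) : HasWinding g m := by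
  obtain ⟨u, hu, hfu⟩ := hf
  exact ⟨u, hu, fun w hw => (h hw).symm.trans (hfu w hw)⟩

theorem mul (hf : HasWinding f m) (hg : HasWinding g k) :
    HasWinding (fun w => f w * g w) (m + k) := by
  obtain ⟨u, hu, hfu⟩ := hf
  obtain ⟨v, hv, hgv⟩ := hg
  refine ⟨fun w => u w + v w, hu.add hv, fun w hw => ?_⟩
  simp only [hfu w hw, hgv w hw, zpow_add₀ (ne_zero_of_mem_sphere hw), Complex.exp_add]
  ring

theorem inv (hf : HasWinding f m) : HasWinding (fun w => (f w)⁻¹) (-m) := by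
  obtain ⟨u, hu, hfu⟩ := hf
  refine ⟨fun w => -u w, hu.neg, fun w hw => ?_⟩
  simp only [hfu w hw, zpow_neg, Complex.exp_neg, mul_inv]

theorem ne_zero (hf : HasWinding f m) {w : ℂ} (hw : w ∈ sphere (0 : ℂ) 1) : f w ≠ 0 := by
  obtain ⟨u, hu, hfu⟩ := hf
  rw [hfu w hw]
  exact mul_ne_zero (zpow_ne_zero _ (ne_zero_of_mem_sphere hw)) (Complex.exp_ne_zero _)

theorem mul_iff (hf : HasWinding f m) :
    HasWinding (fun w => f w * g w) k ↔ HasWinding g (k - m) := by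
  constructor
  · intro h
    have := hf.inv.mul h
    rw [neg_add_eq_sub] at this
    refine this.congr fun w hw => ?_
    simp only
    rw [← mul_assoc, inv_mul_cancel₀ (hf.ne_zero hw), one_mul]
  · intro h
    have := hf.mul h
    rwa [add_sub_cancel] at this

/-- Along `w = exp (iθ)` the total exponent is continuous with values in `2πiℤ`, hence constant. Its
values at `θ = 0` and `θ = 2π` differ by `2πi m`. This is what makes the winding number well
defined. -/
theorem eq_zero_of_one (h : HasWinding (fun _ => 1) m) : m = 0 := by
  obtain ⟨u, hu, hm⟩ := h
  have hmem : ∀ θ : ℝ, Complex.exp (θ * Complex.I) ∈ sphere (0 : ℂ) 1 := fun θ => by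
    rw [mem_sphere_zero_iff_norm, Complex.norm_exp_ofReal_mul_I]
  set φ : ℝ → ℂ := fun θ => m * (θ * Complex.I) + u (Complex.exp (θ * Complex.I)) with hφ
  have hφc : Continuous φ :=
    (by fun_prop : Continuous fun θ : ℝ => (m : ℂ) * (θ * Complex.I)).add
      (hu.comp_continuous (by fun_prop) hmem)
  have hexp : ∀ θ, Complex.exp (φ θ) = 1 := fun θ => by
    have := hm _ (hmem θ)
    simp only at this
    simp only [hφ]
    rw [this, Complex.exp_add, ← Complex.exp_int_mul]
  have hloc : IsLocallyConstant φ := by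
    refine (IsLocallyConstant.iff_eventually_eq φ).2 fun θ => ?_
    filter_upwards [hφc.continuousAt.eventually (ball_mem_nhds (φ θ) one_pos)] with θ' hθ'
    obtain ⟨k, hk⟩ := Complex.exp_eq_exp_iff_exists_int.1 ((hexp θ').trans (hexp θ).symm)
    change dist (φ θ') (φ θ) < 1 at hθ'
    rw [hk, dist_eq_norm, add_sub_cancel_left, norm_mul, norm_mul, norm_mul] at hθ'
    simp only [Complex.norm_I, Complex.norm_ofNat, Complex.norm_real, Complex.norm_intCast,
      Real.norm_eq_abs, abs_of_pos Real.pi_pos, mul_one] at hθ'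
    have hk0 : k = 0 := by
      by_contra hk0
      have h1 : (1 : ℝ) ≤ |(k : ℝ)| := by exact_mod_cast Int.one_le_abs hk0
      nlinarith [Real.pi_gt_three]
    rw [hk, hk0]
    simp
  have h2 := hloc.apply_eq_of_preconnectedSpace (2 * Real.pi) 0
  have h3 : Complex.exp (((2 * Real.pi : ℝ) : ℂ) * Complex.I) = 1 := by
    push_cast
    exact Complex.exp_two_pi_mul_I
  simp only [hφ, h3, Complex.ofReal_zero, zero_mul, Complex.exp_zero, mul_zero, zero_add,
    add_eq_right, mul_eq_zero, Int.cast_eq_zero, Complex.I_ne_zero, or_false,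
    Complex.ofReal_eq_zero, Real.two_pi_pos.ne'] at h2
  exact h2

theorem unique (hf : HasWinding f m) (hf' : HasWinding f k) : m = k := by
  have := (hf.mul hf'.inv).congr (g := fun _ => 1) fun w hw => mul_inv_cancel₀ (hf.ne_zero hw)
  have := this.eq_zero_of_one
  lia

/-- Functions that are close to each other have the same winding number. -/
theorem of_norm_sub_lt (hf : HasWinding f m) (hfc : ContinuousOn f (sphere 0 1))
    (hgc : ContinuousOn g (sphere 0 1)) (h : ∀ w ∈ sphere (0 : ℂ) 1, ‖g w - f w‖ < ‖f w‖) :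
    HasWinding g m := by
  have hs : ∀ w ∈ sphere (0 : ℂ) 1, g w / f w ∈ Complex.slitPlane := fun w hw => by
    refine Complex.ball_one_subset_slitPlane ?_
    have := hf.ne_zero hw
    rw [mem_ball, dist_eq_norm, div_sub_one this, norm_div, div_lt_one (norm_pos_iff.2 this)]
    exact h w hw
  have : HasWinding (fun w => g w / f w) 0 := by
    refine ⟨fun w => Complex.log (g w / f w),
      (hgc.div hfc fun w hw => hf.ne_zero hw).clog hs, fun w hw => ?_⟩
    rw [Complex.exp_log (Complex.slitPlane_ne_zero (hs w hw)), zpow_zero, one_mul]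
  have h2 := hf.mul this
  rw [add_zero] at h2
  exact h2.congr fun w hw => mul_div_cancel₀ _ (hf.ne_zero hw)

theorem const {c : ℂ} (hc : c ≠ 0) : HasWinding (fun _ => c) 0 :=
  ⟨fun _ => Complex.log c, continuousOn_const, fun w _ => by simp [Complex.exp_log hc]⟩

theorem sub_of_norm_lt {v : ℂ} (hv : ‖v‖ < 1) : HasWinding (fun w => w - v) 1 := by
  have : HasWinding (fun w => w) 1 := ⟨fun _ => 0, continuousOn_const, fun w _ => by simp⟩
  refine this.of_norm_sub_lt continuousOn_id (by fun_prop) fun w hw => ?_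
  rw [mem_sphere_zero_iff_norm.1 hw]
  simpa using hv

theorem sub_of_lt_norm {v : ℂ} (hv : 1 < ‖v‖) : HasWinding (fun w => w - v) 0 := by
  have hv0 : v ≠ 0 := norm_pos_iff.1 (one_pos.trans hv)
  refine (const (neg_ne_zero.2 hv0)).of_norm_sub_lt continuousOn_const (by fun_prop) fun w hw => ?_
  simp only [sub_neg_eq_add, sub_add_cancel, norm_neg]
  rwa [mem_sphere_zero_iff_norm.1 hw]

theorem sub_of_forall_norm_lt {c : ℂ → ℂ} (hc : ContinuousOn c (sphere 0 1)) {z : ℂ}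
    (hz : ∀ w ∈ sphere (0 : ℂ) 1, ‖c w‖ < ‖z‖) : HasWinding (fun w => c w - z) 0 := by
  have hz0 : z ≠ 0 := by
    have := (norm_nonneg _).trans_lt (hz 1 (by simp))
    exact norm_pos_iff.1 this
  refine (const (neg_ne_zero.2 hz0)).of_norm_sub_lt continuousOn_const
    (hc.sub continuousOn_const) fun w hw => ?_
  simpa using hz w hw

/-- The index is locally constant off the curve. The equivalence yields both openness and relative
closedness of the sets of given index. -/
theorem eventually_sub_iff {c : ℂ → ℂ} (hc : ContinuousOn c (sphere 0 1)) {z : ℂ}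
    (hz : z ∉ c '' sphere 0 1) : ∀ᶠ z' in 𝓝 z, z' ∉ c '' sphere 0 1 ∧ ∀ m,
      HasWinding (fun w => c w - z') m ↔ HasWinding (fun w => c w - z) m := by
  have hcl : IsClosed (c '' sphere 0 1) := ((isCompact_sphere _ _).image_of_continuousOn hc).isClosed
  obtain ⟨δ, hδ, hb⟩ := Metric.mem_nhds_iff.1 (hcl.isOpen_compl.mem_nhds hz)
  have hd : ∀ w ∈ sphere (0 : ℂ) 1, δ ≤ ‖c w - z‖ := fun w hw => by
    by_contra! h
    exact hb (by rwa [mem_ball, dist_eq_norm]) ⟨w, hw, rfl⟩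
  filter_upwards [ball_mem_nhds z (half_pos hδ)] with z' hz'
  have h1 : ‖z' - z‖ < δ / 2 := by rwa [mem_ball, dist_eq_norm] at hz'
  have hcz : ∀ z, ContinuousOn (fun w => c w - z) (sphere 0 1) := fun z => hc.sub continuousOn_const
  refine ⟨hb (ball_subset_ball (half_le_self hδ.le) hz'), fun m => ⟨fun h => ?_, fun h => ?_⟩⟩
  · refine h.of_norm_sub_lt (hcz _) (hcz _) fun w hw => ?_
    rw [sub_sub_sub_cancel_left]
    have h2 := hd w hw
    have h3 : c w - z = (c w - z') + (z' - z) := by ring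
    rw [h3] at h2
    linarith [norm_add_le (c w - z') (z' - z)]
  · refine h.of_norm_sub_lt (hcz _) (hcz _) fun w hw => ?_
    rw [sub_sub_sub_cancel_left, norm_sub_rev]
    linarith [hd w hw]

/-- The index of a closed curve is constant on connected sets disjoint from the curve. -/
theorem sub_of_isPreconnected {c : ℂ → ℂ} (hc : ContinuousOn c (sphere 0 1)) {P : Set ℂ}
    (hP : IsPreconnected P) (hPc : Disjoint P (c '' sphere 0 1)) {z z' : ℂ} (hz : z ∈ P)
    (h : HasWinding (fun w => c w - z) m) (hz' : z' ∈ P) : HasWinding (fun w => c w - z') m := by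
  have := hP.subset_of_closure_inter_subset
    (u := {z | z ∉ c '' sphere 0 1 ∧ HasWinding (fun w => c w - z) m}) ?_
    ⟨z, hz, disjoint_left.1 hPc hz, h⟩ ?_
  · exact (this hz').2
  · rw [isOpen_iff_mem_nhds]
    rintro x ⟨hx, hxm⟩
    exact (eventually_sub_iff hc hx).mono fun y hy => ⟨hy.1, (hy.2 m).2 hxm⟩
  · rintro x ⟨hx, hxP⟩
    have hxc := disjoint_left.1 hPc hxP
    obtain ⟨y, hy, hy'⟩ := mem_closure_iff_nhds.1 hx _ (eventually_sub_iff hc hxc)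
    exact ⟨hxc, (hy.2 m).1 hy'.2⟩

end HasWinding

/-! ### Retraction onto a filled curve. -/

/-- A closed set bounded by a simple closed curve of index `±1` about an interior point is a retract
of the plane. -/
theorem exists_retraction {c : ℂ → ℂ} (hc : ContinuousOn c (sphere 0 1))
    (hci : InjOn c (sphere 0 1)) {m : ℤ} (hm : m = 1 ∨ m = -1) {D : Set ℂ} (hD : IsOpen D)
    (hDc : Disjoint D (c '' sphere 0 1)) (hcl : IsClosed (D ∪ c '' sphere 0 1)) {z₀ : ℂ}
    (hz₀ : z₀ ∈ D) (hw : HasWinding (fun w => c w - z₀) m) :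
    ∃ R : ℂ → ℂ, Continuous R ∧ (∀ z, R z ∈ D ∪ c '' sphere 0 1) ∧
      ∀ z ∈ D ∪ c '' sphere 0 1, R z = z := by
  obtain ⟨u, hu, hcu⟩ := hw
  have he : IsClosedEmbedding fun w : sphere (0 : ℂ) 1 => c w :=
    (hc.domRestrict).isClosedEmbedding (injOn_iff_injective.1 hci)
  -- Tietze extension, from the curve to the plane, of the exponent in `c w - z₀ = w ^ m * exp (u
  -- w)`.
  obtain ⟨v, hv⟩ := ContinuousMap.exists_extension' he ⟨fun w : sphere (0 : ℂ) 1 => u w, hu.domRestrict⟩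
  have hv' : ∀ w ∈ sphere (0 : ℂ) 1, v (c w) = u w := fun w hw => congrFun hv ⟨w, hw⟩
  -- On the curve the base equals `w ^ m`, and `m * m = 1`, so `η` inverts `c` there. Off `z₀` it is
  -- nonzero, and normalizing it sends the complement of `D` to the circle, hence by `c` to the
  -- curve.
  set η : ℂ → ℂ := fun z => ((z - z₀) * Complex.exp (-v z)) ^ m with hη
  have hη0 : ∀ z ≠ z₀, η z ≠ 0 := fun z hz =>
    zpow_ne_zero _ (mul_ne_zero (sub_ne_zero.2 hz) (Complex.exp_ne_zero _))
  have hηc : ∀ w ∈ sphere (0 : ℂ) 1, η (c w) = w := fun w hw => by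
    have := hcu w hw
    simp only at this
    simp only [hη]
    rw [this, hv' w hw, Complex.exp_neg, mul_assoc, mul_inv_cancel₀ (Complex.exp_ne_zero _),
      mul_one, ← zpow_mul]
    rcases hm with rfl | rfl <;> simp
  have hηcont : ContinuousOn η {z₀}ᶜ := by
    refine ContinuousOn.zpow₀ (by fun_prop) m fun z hz => Or.inl ?_
    exact mul_ne_zero (sub_ne_zero.2 hz) (Complex.exp_ne_zero _)
  have hmem : ∀ z ≠ z₀, η z / ‖η z‖ ∈ sphere (0 : ℂ) 1 := fun z hz => by
    rw [mem_sphere_zero_iff_norm, norm_div, Complex.norm_real, norm_norm,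
      div_self (norm_ne_zero_iff.2 (hη0 z hz))]
  have hcont : ContinuousOn (fun z => c (η z / ‖η z‖)) {z₀}ᶜ := by
    refine hc.comp (hηcont.div (Complex.continuous_ofReal.comp_continuousOn hηcont.norm)
      fun z hz => ?_) hmem
    exact Complex.ofReal_ne_zero.2 (norm_ne_zero_iff.2 (hη0 z hz))
  classical
  set R : ℂ → ℂ := fun z => if z ∈ D then z else c (η z / ‖η z‖) with hR
  have hRid : ∀ z ∈ D ∪ c '' sphere 0 1, R z = z := by
    rintro z (hz | ⟨w, hw, rfl⟩)
    · simp [hR, hz]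
    · have : c w ∉ D := fun h => disjoint_left.1 hDc h ⟨w, hw, rfl⟩
      simp only [hR, this, if_false]
      rw [hηc w hw, mem_sphere_zero_iff_norm.1 hw, Complex.ofReal_one, div_one]
  refine ⟨R, ?_, fun z => ?_, hRid⟩
  · have h1 : ContinuousOn R (D ∪ c '' sphere 0 1) := continuousOn_id.congr hRid
    have h2 : ContinuousOn R Dᶜ := by
      refine (hcont.mono fun z hz => ?_).congr fun z hz => ?_
      · rintro rfl
        exact hz hz₀
      · have : z ∉ D := hz
        simp [hR, this]
    rw [← continuousOn_univ]
    have := h1.union_of_isClosed h2 hcl hD.isClosed_compl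
    exact this.mono fun z _ => by
      by_cases hz : z ∈ D
      · exact Or.inl (Or.inl hz)
      · exact Or.inr hz
  · by_cases hz : z ∈ D
    · simp [hR, hz]
    · simp only [hR, hz, if_false]
      refine Or.inr ⟨_, hmem z ?_, rfl⟩
      rintro rfl
      exact hz hz₀

/-! ### The two sides of the curve -/

variable {r : ℝ} {n : ℕ} {a : ℕ → ℂ}

theorem continuousOn_param : ContinuousOn (param r n a) (sphere 0 1) := fun _ hw =>
  (analyticAt_param (ne_zero_of_mem_sphere hw)).continuousAt.continuousWithinAt

/-- The divided difference of `param`. -/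
def dividedDiff (r : ℝ) (n : ℕ) (a : ℕ → ℂ) (w v : ℂ) : ℂ :=
  r - ∑ j ∈ Finset.range (n + 1), a j * (w⁻¹ * v⁻¹ *
    ∑ i ∈ Finset.range j, w⁻¹ ^ i * v⁻¹ ^ (j - 1 - i))

theorem sub_mul_dividedDiff {w v : ℂ} (hw : w ≠ 0) (hv : v ≠ 0) :
    (w - v) * dividedDiff r n a w v = param r n a w - param r n a v := by
  have h : ∀ j, (w - v) * (a j * (w⁻¹ * v⁻¹ * ∑ i ∈ Finset.range j, w⁻¹ ^ i * v⁻¹ ^ (j - 1 - i))) =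
      a j * (v ^ j)⁻¹ - a j * (w ^ j)⁻¹ := by
    intro j
    have h1 := (Commute.all w⁻¹ v⁻¹).geom_sum₂_mul j
    have h2 : w⁻¹ - v⁻¹ = -((w - v) * (w⁻¹ * v⁻¹)) := by field_simp; ring
    rw [h2] at h1
    rw [← inv_pow, ← inv_pow, ← mul_sub, ← neg_sub (w⁻¹ ^ j), ← h1]
    ring
  rw [dividedDiff, mul_sub, Finset.mul_sum, Finset.sum_congr rfl fun j _ => h j,
    Finset.sum_sub_distrib, param, param]
  ring

theorem continuousAt_dividedDiff {w v : ℂ} (hw : w ≠ 0) (hv : v ≠ 0) :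
    ContinuousAt (fun p : ℂ × ℂ => dividedDiff r n a p.1 p.2) (w, v) := by
  unfold dividedDiff
  have h1 : ContinuousAt (fun p : ℂ × ℂ => p.1⁻¹) (w, v) := continuousAt_fst.inv₀ hw
  have h2 : ContinuousAt (fun p : ℂ × ℂ => p.2⁻¹) (w, v) := continuousAt_snd.inv₀ hv
  fun_prop

theorem dividedDiff_self {w : ℂ} (hw : w ≠ 0) :
    dividedDiff r n a w w = deriv (param r n a) w := by
  have h1 := hasDerivAt_iff_tendsto_slope.1
    (analyticAt_param (r := r) (n := n) (a := a) hw).differentiableAt.hasDerivAt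
  have h2 : ContinuousAt (fun v => dividedDiff r n a v w) w :=
    (continuousAt_dividedDiff hw hw).comp (f := fun v => (v, w)) (by fun_prop)
  refine tendsto_nhds_unique (h2.tendsto.mono_left (nhdsWithin_le_nhds (s := {w}ᶜ)))
    (h1.congr' ?_)
  filter_upwards [self_mem_nhdsWithin,
    nhdsWithin_le_nhds (isOpen_compl_singleton.eventually_mem hw)] with v hv hv0
  have hv1 : v - w ≠ 0 := sub_ne_zero.2 hv
  rw [slope_def_field, ← sub_mul_dividedDiff hv0 hw]
  field_simp

/-- The index of the curve jumps by one across the curve. -/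
theorem eventually_hasWinding_sub_param (hinj : InjOn (param r n a) (sphere 0 1))
    (hd : ∀ w ∈ sphere (0 : ℂ) 1, deriv (param r n a) w ≠ 0) {w₀ : ℂ}
    (hw₀ : w₀ ∈ sphere (0 : ℂ) 1) : ∀ᶠ v in 𝓝 w₀, ∀ m : ℤ,
      (1 < ‖v‖ → (HasWinding (fun w => param r n a w - param r n a v) m ↔
        HasWinding (fun w => dividedDiff r n a w w₀) m)) ∧
      (‖v‖ < 1 → (HasWinding (fun w => param r n a w - param r n a v) m ↔
        HasWinding (fun w => dividedDiff r n a w w₀) (m - 1))) := by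
  have h0 := ne_zero_of_mem_sphere hw₀
  -- Injectivity gives this off the diagonal, and the nonvanishing derivative gives it on the
  -- diagonal.
  have hne : ∀ w ∈ sphere (0 : ℂ) 1, dividedDiff r n a w w₀ ≠ 0 := by
    intro w hw
    rcases eq_or_ne w w₀ with rfl | hne
    · rw [dividedDiff_self h0]
      exact hd w hw
    · intro h
      have := sub_mul_dividedDiff (r := r) (n := n) (a := a) (ne_zero_of_mem_sphere hw) h0
      rw [h, mul_zero] at this
      exact hne (hinj hw hw₀ (sub_eq_zero.1 this.symm))
  have hclose : ∀ᶠ v in 𝓝 w₀, ∀ w ∈ sphere (0 : ℂ) 1,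
      ‖dividedDiff r n a w v - dividedDiff r n a w w₀‖ < ‖dividedDiff r n a w v‖ ∧
      ‖dividedDiff r n a w v - dividedDiff r n a w w₀‖ < ‖dividedDiff r n a w w₀‖ := by
    refine (isCompact_sphere (0 : ℂ) 1).eventually_forall_of_forall_eventually fun w hw => ?_
    have hw0 := ne_zero_of_mem_sphere hw
    have c1 : ContinuousAt (fun p : ℂ × ℂ => dividedDiff r n a p.2 p.1) (w₀, w) :=
      ContinuousAt.comp (x := (w₀, w)) (f := fun p : ℂ × ℂ => (p.2, p.1))
        (g := fun p : ℂ × ℂ => dividedDiff r n a p.1 p.2) (continuousAt_dividedDiff hw0 h0)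
        (by fun_prop)
    have c2 : ContinuousAt (fun p : ℂ × ℂ => dividedDiff r n a p.2 w₀) (w₀, w) :=
      ContinuousAt.comp (x := (w₀, w)) (f := fun p : ℂ × ℂ => (p.2, w₀))
        (g := fun p : ℂ × ℂ => dividedDiff r n a p.1 p.2) (continuousAt_dividedDiff hw0 h0)
        (by fun_prop)
    have hpos := norm_pos_iff.2 (hne w hw)
    exact ((c1.sub c2).norm.eventually_lt c1.norm (by simpa using hpos)).and
      ((c1.sub c2).norm.eventually_lt c2.norm (by simpa using hpos))
  have hcont : ∀ v ≠ 0, ContinuousOn (fun w => dividedDiff r n a w v) (sphere 0 1) :=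
    fun v hv w hw => ((continuousAt_dividedDiff (ne_zero_of_mem_sphere hw) hv).comp
      (f := fun w => (w, v)) (by fun_prop)).continuousWithinAt
  filter_upwards [hclose, isOpen_compl_singleton.eventually_mem h0] with v hv hv0 m
  have hQ : ∀ m, HasWinding (fun w => dividedDiff r n a w v) m ↔
      HasWinding (fun w => dividedDiff r n a w w₀) m := fun m =>
    ⟨fun h => h.of_norm_sub_lt (hcont v hv0) (hcont w₀ h0) fun w hw => by
      rw [norm_sub_rev]; exact (hv w hw).1,
    fun h => h.of_norm_sub_lt (hcont w₀ h0) (hcont v hv0) fun w hw => (hv w hw).2⟩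
  -- The factor `w - v` has winding number 0 or 1 according to the side of `v`. The other factor
  -- keeps the winding number it has at `w₀`.
  have hfac : EqOn (fun w => (w - v) * dividedDiff r n a w v)
      (fun w => param r n a w - param r n a v) (sphere 0 1) := fun w hw =>
    sub_mul_dividedDiff (ne_zero_of_mem_sphere hw) hv0
  have hiff : HasWinding (fun w => param r n a w - param r n a v) m ↔
      HasWinding (fun w => (w - v) * dividedDiff r n a w v) m :=
    ⟨fun h => h.congr hfac.symm, fun h => h.congr hfac⟩
  refine ⟨fun h => ?_, fun h => ?_⟩
  · rw [hiff, (HasWinding.sub_of_lt_norm h).mul_iff, hQ, sub_zero]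
  · rw [hiff, (HasWinding.sub_of_norm_lt h).mul_iff, hQ]

/-- The part of the annulus `1 - ε < |v| < 1 + ε` outside (`s = 1`) or inside (`s = -1`) the unit
circle. -/
def halfAnnulus (s ε : ℝ) : Set ℂ := {v | 0 < s * (‖v‖ - 1) ∧ s * (‖v‖ - 1) < ε}

theorem isPreconnected_setOf_norm_mem {J : Set ℝ} (hJ : IsPreconnected J) (h0 : ∀ x ∈ J, 0 ≤ x) :
    IsPreconnected {v : ℂ | ‖v‖ ∈ J} := by
  have h : {v : ℂ | ‖v‖ ∈ J} = (fun p : ℝ × ℝ => (p.1 : ℂ) *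
      Complex.exp (p.2 * Complex.I)) '' (J ×ˢ univ) := by
    ext v
    constructor
    · intro hv
      exact ⟨(‖v‖, v.arg), ⟨hv, mem_univ _⟩, Complex.norm_mul_exp_arg_mul_I v⟩
    · rintro ⟨⟨x, θ⟩, ⟨hx, -⟩, rfl⟩
      simp only [mem_ofPred_eq]
      rwa [norm_mul, Complex.norm_exp_ofReal_mul_I, Complex.norm_real,
        Real.norm_of_nonneg (h0 x hx), mul_one]
  rw [h]
  exact (hJ.prod isPreconnected_univ).image _ (Continuous.continuousOn (by fun_prop))

theorem isPreconnected_halfAnnulus {s ε : ℝ} (hs : s = 1 ∨ s = -1) (hε : ε < 1) :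
    IsPreconnected (halfAnnulus s ε) := by
  rcases hs with rfl | rfl
  · have h : halfAnnulus 1 ε = {v : ℂ | ‖v‖ ∈ Ioo 1 (1 + ε)} := by
      ext v
      simp only [halfAnnulus, mem_ofPred_eq, mem_Ioo]
      constructor <;> rintro ⟨h1, h2⟩ <;> constructor <;> linarith
    rw [h]
    exact isPreconnected_setOf_norm_mem isPreconnected_Ioo fun x hx => by linarith [hx.1]
  · have h : halfAnnulus (-1) ε = {v : ℂ | ‖v‖ ∈ Ioo (1 - ε) 1} := by
      ext v
      simp only [halfAnnulus, mem_ofPred_eq, mem_Ioo]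
      constructor <;> rintro ⟨h1, h2⟩ <;> constructor <;> linarith
    rw [h]
    exact isPreconnected_setOf_norm_mem isPreconnected_Ioo fun x hx => by linarith [hx.1]

theorem one_add_mul_mem_halfAnnulus {s t ε : ℝ} (hs : s = 1 ∨ s = -1) (ht : t ∈ Ioo 0 ε) (hε : ε ≤ 1) {w : ℂ}
    (hw : w ∈ sphere (0 : ℂ) 1) : ((1 + s * t : ℝ) : ℂ) * w ∈ halfAnnulus s ε := by
  have hx : 0 ≤ 1 + s * t := by
    rcases hs with rfl | rfl <;> linarith [ht.1, ht.2]
  have hss : s * s = 1 := by rcases hs with rfl | rfl <;> norm_num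
  have : s * (‖((1 + s * t : ℝ) : ℂ) * w‖ - 1) = t := by
    rw [norm_mul, mem_sphere_zero_iff_norm.1 hw, Complex.norm_real, Real.norm_of_nonneg hx,
      mul_one, add_sub_cancel_left, ← mul_assoc, hss, one_mul]
  simp only [halfAnnulus, mem_ofPred_eq, this]
  exact ht

theorem abs_norm_sub_one_lt {s ε : ℝ} {v : ℂ} (hs : s = 1 ∨ s = -1) (hv : v ∈ halfAnnulus s ε) :
    |‖v‖ - 1| < ε := by
  obtain ⟨h1, h2⟩ := hv
  rw [abs_lt]
  rcases hs with rfl | rfl <;> constructor <;> linarith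

/-- The curve has a point of maximal modulus, other than the origin. -/
theorem exists_norm_param_max (hinj : InjOn (param r n a) (sphere 0 1)) :
    ∃ w₀ ∈ sphere (0 : ℂ) 1, 0 < ‖param r n a w₀‖ ∧
      ∀ w ∈ sphere (0 : ℂ) 1, ‖param r n a w‖ ≤ ‖param r n a w₀‖ := by
  obtain ⟨w₀, hw₀, hmax⟩ := (isCompact_sphere (0 : ℂ) 1).exists_isMaxOn ⟨1, by simp⟩
    (continuousOn_param (r := r) (n := n) (a := a)).norm
  have hmax' : ∀ w ∈ sphere (0 : ℂ) 1, ‖param r n a w‖ ≤ ‖param r n a w₀‖ := fun w hw => hmax hw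
  refine ⟨w₀, hw₀, ?_, hmax'⟩
  rw [norm_pos_iff]
  intro h0
  have h1 : ∀ w ∈ sphere (0 : ℂ) 1, param r n a w = 0 := fun w hw => by
    have := hmax' w hw
    rwa [h0, norm_zero, norm_le_zero_iff] at this
  have h2 := @hinj 1 (by simp) (-1) (by simp)
    ((h1 1 (by simp)).trans (h1 (-1) (by simp)).symm)
  norm_num at h2

theorem exists_annulus_subset {U : Set ℂ} (hU : U ∈ 𝓝ˢ (sphere (0 : ℂ) 1)) :
    ∃ ε > 0, ε < 1 ∧ ∀ v : ℂ, |‖v‖ - 1| < ε → v ∈ U := by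
  obtain ⟨V, hV, hsV, hVU⟩ := mem_nhdsSet_iff_exists.1 hU
  obtain ⟨δ, hδ, h⟩ := (isCompact_sphere (0 : ℂ) 1).exists_thickening_subset_open hV hsV
  -- The bound `1 / 2` keeps `v` away from `0`, so that `v / ‖v‖` is a nearby point of the circle.
  refine ⟨min δ (1 / 2), by positivity, (min_le_right _ _).trans_lt (by norm_num), fun v hv => ?_⟩
  have hv0 : v ≠ 0 := by
    rintro rfl
    have := hv.trans_le (min_le_right _ _)
    norm_num at this
  have hvn : (‖v‖ : ℂ) ≠ 0 := Complex.ofReal_ne_zero.2 (norm_ne_zero_iff.2 hv0)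
  refine hVU (h (mem_thickening_iff.2 ⟨v / ‖v‖, ?_, ?_⟩))
  · rw [mem_sphere_zero_iff_norm, norm_div, Complex.norm_real, norm_norm,
      div_self (norm_ne_zero_iff.2 hv0)]
  · have : v - v / ‖v‖ = (v / ‖v‖) * ((‖v‖ - 1 : ℝ) : ℂ) := by
      push_cast
      field_simp
    rw [dist_eq_norm, this, norm_mul, norm_div, Complex.norm_real, norm_norm,
      div_self (norm_ne_zero_iff.2 hv0), one_mul, Complex.norm_real]
    exact hv.trans_le (min_le_left _ _)

theorem exists_injOn_annulus (hinj : InjOn (param r n a) (sphere 0 1))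
    (hd : ∀ w ∈ sphere (0 : ℂ) 1, deriv (param r n a) w ≠ 0) :
    ∃ U, IsOpen U ∧ sphere 0 1 ⊆ U ∧ InjOn (param r n a) U := by
  refine hinj.exists_isOpen_superset (isCompact_sphere _ _) (fun w hw =>
    (analyticAt_param (ne_zero_of_mem_sphere hw)).continuousAt) fun w hw => ?_
  obtain ⟨φ, -, -, -, h⟩ := exists_analytic_local_inverse
    (analyticAt_param (ne_zero_of_mem_sphere hw)) (hd w hw)
  exact ⟨_, h, LeftInvOn.injOn (f₁' := φ) fun v hv => hv⟩

/-- One of the two sides of the curve has index `±1`. -/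
theorem exists_halfAnnulus_hasWinding (hinj : InjOn (param r n a) (sphere 0 1))
    (hd : ∀ w ∈ sphere (0 : ℂ) 1, deriv (param r n a) w ≠ 0) {ε : ℝ} (hε : 0 < ε) (hε1 : ε < 1)
    (hA : InjOn (param r n a) {v | |‖v‖ - 1| < ε}) :
    ∃ s : ℝ, (s = 1 ∨ s = -1) ∧ ∃ m : ℤ, (m = 1 ∨ m = -1) ∧ ∀ v ∈ halfAnnulus s ε,
      HasWinding (fun w => param r n a w - param r n a v) m := by
  set h := param r n a with hh
  obtain ⟨w₀, hw₀, hz0, hmax'⟩ := exists_norm_param_max hinj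
  have hj := eventually_hasWinding_sub_param hinj hd hw₀
  have hconst : ∀ {s : ℝ} {v : ℂ} {m : ℤ}, (s = 1 ∨ s = -1) → v ∈ halfAnnulus s ε →
      HasWinding (fun w => h w - h v) m → ∀ v' ∈ halfAnnulus s ε,
      HasWinding (fun w => h w - h v') m := by
    intro s v m hs hv hw v' hv'
    refine HasWinding.sub_of_isPreconnected continuousOn_param
      ((isPreconnected_halfAnnulus hs hε1).image h fun x hx => ?_) ?_
      (mem_image_of_mem h hv) hw (mem_image_of_mem h hv')
    · refine (analyticAt_param ?_).continuousAt.continuousWithinAt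
      rintro rfl
      have := (abs_lt.1 ((abs_norm_sub_one_lt hs hx).trans hε1)).1
      norm_num at this
    · rw [disjoint_left]
      rintro _ ⟨x, hx, rfl⟩ ⟨w, hw, hxw⟩
      rw [mem_sphere_zero_iff_norm] at hw
      have h1 := hA (by simp [hw, hε]) (abs_norm_sub_one_lt hs hx) hxw
      rw [← h1, halfAnnulus, mem_ofPred_eq, hw] at hx
      simp at hx
  have hray : ∀ {s : ℝ}, (s = 1 ∨ s = -1) → ∃ v ∈ halfAnnulus s ε, ∀ m : ℤ,
      (1 < ‖v‖ → (HasWinding (fun w => h w - h v) m ↔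
        HasWinding (fun w => dividedDiff r n a w w₀) m)) ∧
      (‖v‖ < 1 → (HasWinding (fun w => h w - h v) m ↔
        HasWinding (fun w => dividedDiff r n a w w₀) (m - 1))) := by
    intro s hs
    have ht : Tendsto (fun x : ℝ => ((1 + s * x : ℝ) : ℂ) * w₀) (𝓝[>] 0) (𝓝 w₀) := by
      have : Continuous fun x : ℝ => ((1 + s * x : ℝ) : ℂ) * w₀ := by fun_prop
      have := this.tendsto 0
      simp only [mul_zero, add_zero, Complex.ofReal_one, one_mul] at this
      exact this.mono_left nhdsWithin_le_nhds
    obtain ⟨x, hx1, hx2⟩ := ((ht.eventually hj).and (Ioo_mem_nhdsGT hε)).exists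
    exact ⟨_, one_add_mul_mem_halfAnnulus hs hx2 hε1.le hw₀, hx1⟩
  obtain ⟨φ, hφa, hφ0, hφ, -⟩ := exists_analytic_local_inverse
    (analyticAt_param (ne_zero_of_mem_sphere hw₀)) (hd w₀ hw₀)
  -- Pushing the point of maximal modulus radially outwards leads to index 0. Its preimage `v` near
  -- `w₀` shows which side has index 0, and the jump by one gives `±1` on the opposite side.
  have ht : Tendsto (fun t : ℝ => (t : ℂ) * h w₀) (𝓝[>] 1) (𝓝 (h w₀)) := by
    have : Continuous fun t : ℝ => (t : ℂ) * h w₀ := by fun_prop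
    have := this.tendsto 1
    simp only [Complex.ofReal_one, one_mul] at this
    exact this.mono_left nhdsWithin_le_nhds
  have hφt : Tendsto φ (𝓝 (h w₀)) (𝓝 w₀) := by
    have := hφa.continuousAt.tendsto
    rwa [hφ0] at this
  obtain ⟨t, ht1, ht2, ht3⟩ := ((((hφt.comp ht).eventually hj)).and
    ((ht.eventually hφ).and self_mem_nhdsWithin)).exists
  set v := φ ((t : ℂ) * h w₀)
  have ht3' : (1 : ℝ) < t := ht3
  have hv : h v = t * h w₀ := ht2
  have hlarge : ∀ w ∈ sphere (0 : ℂ) 1, ‖h w‖ < ‖h v‖ := fun w hw => by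
    rw [hv, norm_mul, Complex.norm_real, Real.norm_of_nonneg (by linarith)]
    exact (hmax' w hw).trans_lt (lt_mul_of_one_lt_left hz0 ht3')
  have hwind : HasWinding (fun w => h w - h v) 0 :=
    HasWinding.sub_of_forall_norm_lt continuousOn_param hlarge
  rcases lt_trichotomy ‖v‖ 1 with hv1 | hv1 | hv1
  · have hQ := ((ht1 0).2 hv1).1 hwind
    obtain ⟨v', hv', hv'm⟩ := hray (s := 1) (Or.inl rfl)
    refine ⟨1, Or.inl rfl, -1, Or.inr rfl, hconst (Or.inl rfl) hv' ?_⟩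
    refine ((hv'm _).1 ?_).2 (by simpa using hQ)
    linarith [hv'.1]
  · exact absurd (hlarge v (by simpa using hv1)) (lt_irrefl _)
  · have hQ := ((ht1 0).1 hv1).1 hwind
    obtain ⟨v', hv', hv'm⟩ := hray (s := -1) (Or.inr rfl)
    refine ⟨-1, Or.inr rfl, 1, Or.inl rfl, hconst (Or.inr rfl) hv' ?_⟩
    refine ((hv'm _).2 ?_).2 (by simpa using hQ)
    linarith [hv'.1]

end

section

variable {r : ℝ} {n : ℕ} {a : ℕ → ℂ} {γ Ω : Set ℂ} {S : ℂ → ℂ}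

/-! ### Schwarz functions of the curve -/

/-- The function is `T ∘ h⁻¹` on the image of an annulus where `h` is injective without critical
points. There the set-theoretic inverse agrees locally with the analytic one. -/
theorem exists_isSchwarzFunction (hinj : InjOn (param r n a) (sphere 0 1))
    (hd : ∀ w ∈ sphere (0 : ℂ) 1, deriv (param r n a) w ≠ 0) :
    ∃ Ω S, IsSchwarzFunction (param r n a '' sphere 0 1) Ω S := by
  obtain ⟨V, hV, hsV, hVi⟩ := exists_injOn_annulus hinj hd
  have hU : {v : ℂ | v ∈ V ∧ v ≠ 0 ∧ deriv (param r n a) v ≠ 0} ∈ 𝓝ˢ (sphere (0 : ℂ) 1) := by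
    refine mem_nhdsSet_iff_forall.2 fun w hw => ?_
    have hw0 := ne_zero_of_mem_sphere hw
    exact (hV.eventually_mem (hsV hw)).and ((isOpen_compl_singleton.eventually_mem hw0).and
      ((analyticAt_param hw0).deriv.continuousAt.eventually_ne (hd w hw)))
  obtain ⟨ε, hε, hε1, hA⟩ := exists_annulus_subset hU
  set A : Set ℂ := {v | |‖v‖ - 1| < ε} with hAdef
  have hAo : IsOpen A := isOpen_lt (by fun_prop) continuous_const
  have hAc : IsConnected A := by
    have : A = {v : ℂ | ‖v‖ ∈ Ioo (1 - ε) (1 + ε)} := by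
      ext v
      simp only [hAdef, mem_ofPred_eq, mem_Ioo, abs_lt]
      constructor <;> rintro ⟨h1, h2⟩ <;> constructor <;> linarith
    refine ⟨⟨1, by simp [hAdef, hε]⟩, ?_⟩
    rw [this]
    exact isPreconnected_setOf_norm_mem isPreconnected_Ioo fun x hx => by linarith [hx.1]
  have hsA : sphere (0 : ℂ) 1 ⊆ A := fun w hw => by
    simp [hAdef, mem_sphere_zero_iff_norm.1 hw, hε]
  have hinjA : InjOn (param r n a) A := hVi.mono fun v hv => (hA v hv).1
  set k := Function.invFunOn (param r n a) A with hk
  have hkA : ∀ v ∈ A, k (param r n a v) = v := fun v hv => hinjA.leftInvOn_invFunOn hv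
  have hloc : ∀ v ∈ A, AnalyticAt ℂ k (param r n a v) ∧
      ∀ᶠ z in 𝓝 (param r n a v), z ∈ param r n a '' A := by
    intro v hv
    obtain ⟨φ, h1, h2, h3, -⟩ := exists_analytic_local_inverse
      (analyticAt_param (hA v hv).2.1) (hA v hv).2.2
    have h4 : ∀ᶠ z in 𝓝 (param r n a v), φ z ∈ A :=
      h1.continuousAt.eventually (hAo.eventually_mem (by rwa [h2]))
    refine ⟨h1.congr ?_, ?_⟩
    · filter_upwards [h3, h4] with z hz hz'
      conv_rhs => rw [← hz, hkA _ hz']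
    · filter_upwards [h3, h4] with z hz hz'
      exact ⟨φ z, hz', hz⟩
  refine ⟨param r n a '' A, fun z => dual r n a (k z), ⟨?_, ?_, image_mono hsA, ?_, ?_⟩⟩
  · rw [isOpen_iff_mem_nhds]
    rintro _ ⟨v, hv, rfl⟩
    exact (hloc v hv).2
  · exact hAc.image _ fun v hv => (analyticAt_param (hA v hv).2.1).continuousAt.continuousWithinAt
  · rintro _ ⟨v, hv, rfl⟩
    refine AnalyticAt.comp (g := dual r n a) ?_ (hloc v hv).1
    rw [hkA v hv]
    exact analyticAt_dual (hA v hv).2.1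
  · rintro _ ⟨v, hv, rfl⟩
    simp only [hkA v (hsA hv), dual_eq_conj_param hv]

/-- Both sides are analytic near `w` and agree on the circle, which accumulates at `w`. -/
theorem IsSchwarzFunction.eventually_comp_param
    (hS : IsSchwarzFunction (param r n a '' sphere 0 1) Ω S) {w : ℂ} (hw : w ∈ sphere (0 : ℂ) 1) :
    ∀ᶠ v in 𝓝 w, S (param r n a v) = dual r n a v := by
  have hw0 := ne_zero_of_mem_sphere hw
  have h1 : AnalyticAt ℂ (fun v => S (param r n a v)) w :=
    (hS.analytic _ (hS.subset ⟨w, hw, rfl⟩)).comp (analyticAt_param hw0)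
  refine (h1.frequently_eq_iff_eventually_eq (analyticAt_dual hw0)).1 ?_
  have ht : Tendsto (fun θ : ℝ => w * Complex.exp (θ * Complex.I)) (𝓝[>] 0) (𝓝[≠] w) := by
    refine tendsto_nhdsWithin_iff.2 ⟨?_, ?_⟩
    · have : Continuous fun θ : ℝ => w * Complex.exp (θ * Complex.I) := by fun_prop
      have := this.tendsto 0
      simp only [Complex.ofReal_zero, zero_mul, Complex.exp_zero, mul_one] at this
      exact this.mono_left nhdsWithin_le_nhds
    · filter_upwards [Ioo_mem_nhdsGT Real.pi_pos] with θ hθ h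
      have h2 : Complex.exp (θ * Complex.I) = 1 := mul_left_cancel₀ hw0 (by rw [mul_one]; exact h)
      have h3 : Real.sin θ = 0 := by
        rw [← Complex.exp_ofReal_mul_I_im, h2, Complex.one_im]
      exact (Real.sin_pos_of_mem_Ioo hθ).ne' h3
  refine ht.frequently (Eventually.frequently (Eventually.of_forall fun θ => ?_))
  have hm : w * Complex.exp (θ * Complex.I) ∈ sphere (0 : ℂ) 1 := by
    rw [mem_sphere_zero_iff_norm, norm_mul, Complex.norm_exp_ofReal_mul_I,
      mem_sphere_zero_iff_norm.1 hw, one_mul]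
  rw [hS.eq_conj _ ⟨_, hm, rfl⟩, dual_eq_conj_param hm]

theorem IsSchwarzFunction.isAlgGerm (hS : IsSchwarzFunction (param r n a '' sphere 0 1) Ω S)
    (hd : ∀ w ∈ sphere (0 : ℂ) 1, deriv (param r n a) w ≠ 0) {z : ℂ}
    (hz : z ∈ param r n a '' sphere 0 1) : IsAlgGerm r n a z S := by
  obtain ⟨w, hw, rfl⟩ := hz
  have hw0 := ne_zero_of_mem_sphere hw
  obtain ⟨φ, h1, h2, h3, -⟩ := exists_analytic_local_inverse (analyticAt_param hw0) (hd w hw)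
  have h4 : ∀ᶠ v in 𝓝 w, v ≠ 0 := isOpen_compl_singleton.eventually_mem hw0
  have h5 := h1.continuousAt.eventually (h2.symm ▸ (hS.eventually_comp_param hw).and h4)
  filter_upwards [h3, h5] with z hz hz'
  exact ⟨φ z, hz'.2, hz, by rw [← hz'.1, hz]⟩

/-- A function that is analytic on `Ω` has no branch points in `Ω`. -/
theorem IsSchwarzFunction.not_isBranchPoint (hS : IsSchwarzFunction γ Ω S) (p : ℂ) :
    ¬ IsBranchPoint S γ Ω p := by
  rintro ⟨ε, -, hb, z, hz, q, -, c, g, hc, hcg, hbr⟩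
  have h1 : ContinuesTo c S S := by
    refine ContinuesTo.of_analyticAt fun t => hS.analytic _ ?_
    rcases eq_or_lt_of_le (show (0 : I) ≤ t from t.2.1) with rfl | ht
    · rw [c.source]
      exact hS.subset hz
    · exact hc t ht
  exact not_branchesAround_of_analyticOnNhd (fun z hz => hS.analytic z (hb hz.1)) (h1.unique hcg) hbr

theorem IsSchwarzFunction.mem_criticalValues_of_isBranchPoint (hn : 1 ≤ n) (hr : 0 < r)
    (ha : a n ≠ 0) (hS : IsSchwarzFunction (param r n a '' sphere 0 1) Ω S)
    (hd : ∀ w ∈ sphere (0 : ℂ) 1, deriv (param r n a) w ≠ 0) {G : Set ℂ} {p : ℂ}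
    (h : IsBranchPoint S (param r n a '' sphere 0 1) G p) : p ∈ criticalValues r n a := by
  obtain ⟨ε, hε, hb, z, hz, q, hq, c, g, hc, hcg, hbr⟩ := h
  by_contra hp
  exact not_branchesAround_of_notMem_criticalValues hn hr ha hε hp hq
    (hcg.isAlgGerm hn hr ha (hS.isAlgGerm hd hz)) hbr

/-! ### The maximum principle -/

/-- The maximum modulus principle for `exp g` and `exp (-g)`, since `‖exp g‖ = exp (re g)`. -/
theorem abs_re_le_of_forall_frontier {U : Set ℂ} {g : ℂ → ℂ} {δ : ℝ} (hU : Bornology.IsBounded U)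
    (hg : DiffContOnCl ℂ g U) (h : ∀ z ∈ frontier U, |(g z).re| ≤ δ) {z : ℂ} (hz : z ∈ closure U) :
    |(g z).re| ≤ δ := by
  have key : ∀ g : ℂ → ℂ, DiffContOnCl ℂ g U → (∀ z ∈ frontier U, (g z).re ≤ δ) →
      (g z).re ≤ δ := by
    intro g hg h
    have h1 : DiffContOnCl ℂ (fun z => Complex.exp (g z)) U :=
      Complex.differentiable_exp.comp_diffContOnCl hg
    have := Complex.norm_le_of_forall_mem_frontier_norm_le hU h1 (C := Real.exp δ)
      (fun z hz => by rw [Complex.norm_exp]; exact Real.exp_le_exp.2 (h z hz)) hz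
    rwa [Complex.norm_exp, Real.exp_le_exp] at this
  refine abs_le.2 ⟨?_, key g hg fun z hz => (abs_le.1 (h z hz)).2⟩
  have := key (fun z => -g z) hg.neg fun z hz => by
    rw [Complex.neg_re]
    linarith [(abs_le.1 (h z hz)).1]
  rw [Complex.neg_re] at this
  linarith

/-- The distance of an analytic function from complex conjugation is controlled by its values on
the boundary. -/
theorem norm_sub_conj_le_of_forall_frontier {U : Set ℂ} {f : ℂ → ℂ} {δ : ℝ}
    (hU : Bornology.IsBounded U) (hf : DiffContOnCl ℂ f U)
    (h : ∀ z ∈ frontier U, ‖f z - conj z‖ ≤ δ) {z : ℂ} (hz : z ∈ closure U) :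
    ‖f z - conj z‖ ≤ 2 * δ := by
  have hid : DiffContOnCl ℂ (fun z : ℂ => z) U := differentiable_id.diffContOnCl
  -- The real part of `f z - conj z` is that of `f z - z`, and its imaginary part is that of `f z +
  -- z`. Each is bounded by `δ`, whence the factor 2.
  have h1 := abs_re_le_of_forall_frontier (δ := δ) hU (hf.sub hid) (fun z hz => by
    have := (Complex.abs_re_le_norm _).trans (h z hz)
    simpa using this) hz
  have h2 := abs_re_le_of_forall_frontier (δ := δ) hU ((hf.add hid).const_smul Complex.I)
    (fun z hz => by
      have := (Complex.abs_im_le_norm _).trans (h z hz)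
      rw [← abs_neg] at this
      simpa using this) hz
  refine (Complex.norm_le_abs_re_add_abs_im _).trans ?_
  rw [two_mul]
  refine add_le_add ?_ ?_
  · simpa using h1
  · rw [← abs_neg]
    simpa using h2

/-- On the circle `ρ² = (z - z₀) * conj (z - z₀)`, so the analytic function `ρ² - (z - z₀) * (f z -
conj z₀)` has modulus at most `ρ * C` there, while its value at the centre is `ρ²`. -/
theorem le_of_forall_norm_sub_conj_le {f : ℂ → ℂ} {z₀ : ℂ} {ρ C : ℝ} (hρ : 0 < ρ)
    (hf : DiffContOnCl ℂ f (ball z₀ ρ)) (h : ∀ z ∈ sphere z₀ ρ, ‖f z - conj z‖ ≤ C) : ρ ≤ C := by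
  have hid : DiffContOnCl ℂ (fun z : ℂ => z - z₀) (ball z₀ ρ) :=
    (differentiable_id.sub_const z₀).diffContOnCl
  have h1 : DiffContOnCl ℂ (fun z => (ρ : ℂ) ^ 2 - (z - z₀) • (f z - conj z₀)) (ball z₀ ρ) :=
    (hid.smul (hf.sub_const _)).const_sub _
  have h2 := Complex.norm_le_of_forall_mem_frontier_norm_le (C := ρ * C) isBounded_ball h1
    (fun z hz => ?_) (subset_closure (mem_ball_self hρ))
  · rw [sub_self, zero_smul, sub_zero, norm_pow, Complex.norm_real, Real.norm_of_nonneg hρ.le,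
      pow_two] at h2
    exact le_of_mul_le_mul_left h2 hρ
  · have hz' := frontier_ball_subset_sphere hz
    have h3 : ‖z - z₀‖ = ρ := by rwa [mem_sphere, dist_eq_norm] at hz'
    have h4 : (ρ : ℂ) ^ 2 = (z - z₀) * conj (z - z₀) := by
      rw [Complex.mul_conj, Complex.normSq_eq_norm_sq, h3]
      push_cast
      rfl
    rw [h4, map_sub, smul_eq_mul, ← mul_sub, norm_mul, h3, sub_sub_sub_cancel_right, norm_sub_rev]
    exact mul_le_mul_of_nonneg_left (h z hz') hρ.le

/-! ### The interior domain -/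

theorem isOpen_interiorDomain (hγ : IsClosed γ) : IsOpen (interiorDomain γ) := by
  rw [isOpen_iff_mem_nhds]
  rintro z ⟨hz, hb⟩
  filter_upwards [(hγ.isOpen_compl.connectedComponentIn).mem_nhds (mem_connectedComponentIn hz)]
    with y hy
  exact ⟨connectedComponentIn_subset _ _ hy, by rwa [← connectedComponentIn_eq hy]⟩

/-- `P` contains a point farther from the origin than the whole curve, where the index is 0. -/
theorem HasWinding.sub_of_not_isBounded {c : ℂ → ℂ} (hc : ContinuousOn c (sphere 0 1)) {P : Set ℂ}
    (hP : IsPreconnected P) (hPc : Disjoint P (c '' sphere 0 1)) (hb : ¬ Bornology.IsBounded P)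
    {z : ℂ} (hz : z ∈ P) : HasWinding (fun w => c w - z) 0 := by
  obtain ⟨B, hB⟩ := (isCompact_sphere (0 : ℂ) 1).exists_bound_of_continuousOn hc
  have : ∃ y ∈ P, B < ‖y‖ := by
    by_contra! h
    exact hb (isBounded_iff_forall_norm_le.2 ⟨B, h⟩)
  obtain ⟨y, hy, hBy⟩ := this
  exact HasWinding.sub_of_isPreconnected hc hP hPc hy
    (HasWinding.sub_of_forall_norm_lt hc fun w hw => (hB w hw).trans_lt hBy) hz

theorem mem_interiorDomain_of_hasWinding {c : ℂ → ℂ} (hc : ContinuousOn c (sphere 0 1)) {z : ℂ}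
    {m : ℤ} (hm : m ≠ 0) (h : HasWinding (fun w => c w - z) m) :
    z ∈ interiorDomain (c '' sphere 0 1) := by
  have hz : z ∈ (c '' sphere 0 1)ᶜ := by
    rintro ⟨w, hw, rfl⟩
    exact h.ne_zero hw (sub_self _)
  refine ⟨hz, ?_⟩
  by_contra hb
  exact hm (h.unique (HasWinding.sub_of_not_isBounded hc isPreconnected_connectedComponentIn
    (disjoint_left.2 fun y hy => connectedComponentIn_subset _ _ hy) hb
    (mem_connectedComponentIn hz)))

/-- A point of nonzero index about a closed curve all whose points have nonzero index about `γ`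
lies in the interior domain of `γ`. -/
theorem mem_interiorDomain_of_hasWinding_of_hasWinding
    (hinj : InjOn (param r n a) (sphere 0 1)) {c : ℂ → ℂ} (hc : ContinuousOn c (sphere 0 1))
    {m : ℤ} (hm : m ≠ 0)
    (hcw : ∀ v ∈ sphere (0 : ℂ) 1, HasWinding (fun w => param r n a w - c v) m) {z : ℂ}
    (hz : HasWinding (fun w => c w - z) m) : z ∈ interiorDomain (param r n a '' sphere 0 1) := by
  set γ := param r n a '' sphere 0 1 with hγ
  by_contra hzD
  suffices ∃ P, IsPreconnected P ∧ Disjoint P (c '' sphere 0 1) ∧ ¬ Bornology.IsBounded P ∧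
      z ∈ P by
    obtain ⟨P, h1, h2, h3, h4⟩ := this
    exact hm (hz.unique (HasWinding.sub_of_not_isBounded hc h1 h2 h3 h4))
  by_cases hzγ : z ∈ γ
  · obtain ⟨w₀, hw₀, hpos, hmax⟩ := exists_norm_param_max hinj
    -- The curve `γ` joined to infinity by a ray from its farthest point. Beyond `γ` the ray has
    -- index 0 about `γ`, so it cannot meet `c`.
    set ray : Set ℂ := (fun t : ℝ => (t : ℂ) * param r n a w₀) '' Ici 1 with hray
    have hray1 : param r n a w₀ ∈ ray := ⟨1, self_mem_Ici, by simp⟩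
    refine ⟨γ ∪ ray, IsPreconnected.union _ ⟨w₀, hw₀, rfl⟩ hray1 ?_ ?_, ?_, ?_, Or.inl hzγ⟩
    · exact (isPreconnected_sphere (by simp) _ _).image _ continuousOn_param
    · exact isPreconnected_Ici.image _ (Continuous.continuousOn (by fun_prop))
    · have hγc : Disjoint γ (c '' sphere 0 1) := by
        rw [disjoint_left]
        rintro _ ⟨w, hw, rfl⟩ ⟨v, hv, hvw⟩
        exact (hcw v hv).ne_zero hw (by rw [hvw, sub_self])
      refine disjoint_union_left.2 ⟨hγc, ?_⟩
      rw [disjoint_left]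
      rintro _ ⟨t, ht, rfl⟩ ⟨v, hv, hvt⟩
      rcases (mem_Ici.1 ht).eq_or_lt with rfl | ht
      · refine disjoint_left.1 hγc ⟨w₀, hw₀, rfl⟩ ⟨v, hv, ?_⟩
        simpa using hvt
      · refine hm ((hcw v hv).unique (HasWinding.sub_of_forall_norm_lt continuousOn_param
          fun w hw => ?_))
        rw [hvt, norm_mul, Complex.norm_real, Real.norm_of_nonneg (by linarith)]
        exact (hmax w hw).trans_lt (lt_mul_of_one_lt_left hpos ht)
    · intro hb
      obtain ⟨B, hB⟩ := isBounded_iff_forall_norm_le.1 (hb.subset subset_union_right)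
      have h1 := hB _ ⟨max 1 ((B + 1) / ‖param r n a w₀‖), mem_Ici.2 (le_max_left _ _), rfl⟩
      rw [norm_mul, Complex.norm_real, Real.norm_of_nonneg (by positivity)] at h1
      have h2 := mul_le_mul_of_nonneg_right
        (le_max_right 1 ((B + 1) / ‖param r n a w₀‖)) hpos.le
      rw [div_mul_cancel₀ _ hpos.ne'] at h2
      linarith
  -- A point of `c` in this component would have nonzero index about `γ`, which would make the
  -- component bounded.
  · refine ⟨connectedComponentIn γᶜ z, isPreconnected_connectedComponentIn, ?_,
      fun hb => hzD ⟨hzγ, hb⟩, mem_connectedComponentIn hzγ⟩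
    rw [disjoint_left]
    rintro _ hy ⟨v, hv, rfl⟩
    have h1 := mem_interiorDomain_of_hasWinding continuousOn_param hm (hcw v hv)
    refine hzD ⟨hzγ, ?_⟩
    rw [connectedComponentIn_eq hy]
    exact h1.2

/-! ### Existence of a branch point -/

/-- If `S` can be continued from the curve along all paths in the interior domain, then it is given,
inside a curve parallel to `γ`, by a function analytic there. -/
theorem exists_diffContOnCl_of_continuesTo {c : ℂ → ℂ} (hc : ContinuousOn c (sphere 0 1))
    {D K : Set ℂ} (hD : IsOpen D) (hK : K = D ∪ c '' sphere 0 1) (hKc : IsClosed K) {R : ℂ → ℂ}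
    (hR : Continuous R) (hRid : ∀ z ∈ K, R z = z) {x₀ : ℂ} (hx₀ : x₀ ∈ c '' sphere 0 1)
    (hS : ∀ z ∈ c '' sphere 0 1, AnalyticAt ℂ S z)
    (hcont : ∀ y, ∃ g, ContinuesTo (segmentPath hR x₀ y) S g) :
    ∃ f, DiffContOnCl ℂ f D ∧ EqOn f S (c '' sphere 0 1) := by
  obtain ⟨F, hF, hF0⟩ := exists_germSection_of_segmentPath hR hcont
  -- On `K` the retraction is the identity, so the germ `F z` sits at `z` itself and the diagonal `F
  -- z z` is a genuine function.
  have hloc : ∀ z ∈ K, ∀ᶠ y in 𝓝 z, y ∈ K → F y y = F z y := fun z hz => by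
    filter_upwards [hF.eventuallyEq z] with y hy hyK
    rw [hRid y hyK] at hy
    exact hy.eq_of_nhds
  have hcon : ContinuousOn (fun z => F z z) K := fun z hz => by
    have h1 := hF.analyticAt z
    rw [hRid z hz] at h1
    exact h1.continuousAt.continuousWithinAt.congr_of_eventuallyEq_of_mem
      (eventually_nhdsWithin_iff.2 (hloc z hz)) hz
  refine ⟨fun z => F z z, ⟨fun z hz => ?_, hcon.mono (closure_minimal ?_ hKc)⟩, ?_⟩
  · have hzK : z ∈ K := hK ▸ Or.inl hz
    have h1 := hF.analyticAt z
    rw [hRid z hzK] at h1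
    refine (h1.differentiableAt.congr_of_eventuallyEq ?_).differentiableWithinAt
    filter_upwards [hloc z hzK, hD.eventually_mem hz] with y hy hyD
    exact hy (hK ▸ Or.inl hyD)
  · exact hK ▸ subset_union_left
  · have hid : ∀ z ∈ c '' sphere 0 1, R z = z := fun z hz => hRid z (hK ▸ Or.inr hz)
    have hpre : IsPreconnected (c '' sphere 0 1) :=
      (isPreconnected_sphere (by simp) _ _).image _ hc
    have := isPreconnected_iff_preconnectedSpace.1 hpre
    have h1 := hF.comp (k := (Subtype.val : c '' sphere 0 1 → ℂ)) continuous_subtype_val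
    intro z hz
    have h2 := h1.eventuallyEq_of_eventuallyEq (hR.comp continuous_subtype_val)
      (GermSection.const (g := S) fun y => by
        rw [Function.comp_apply, hid y y.2]; exact hS y y.2) (x₀ := ⟨x₀, hx₀⟩) hF0 ⟨z, hz⟩
    simp only [Function.comp_apply, hid z hz] at h2
    exact h2.eq_of_nhds

theorem IsSchwarzFunction.exists_isBranchPoint (hn : 1 ≤ n) (hr : 0 < r) (ha : a n ≠ 0)
    (hinj : InjOn (param r n a) (sphere 0 1))
    (hd : ∀ w ∈ sphere (0 : ℂ) 1, deriv (param r n a) w ≠ 0)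
    (hS : IsSchwarzFunction (param r n a '' sphere 0 1) Ω S) :
    ∃ p ∈ interiorDomain (param r n a '' sphere 0 1), IsBranchPoint S (param r n a '' sphere 0 1)
      (interiorDomain (param r n a '' sphere 0 1)) p := by
  by_contra! hnb
  set γ := param r n a '' sphere 0 1 with hγ
  have hγc : IsClosed γ := ((isCompact_sphere _ _).image_of_continuousOn continuousOn_param).isClosed
  have hDo := isOpen_interiorDomain hγc
  obtain ⟨V, hV, hsV, hVi⟩ := exists_injOn_annulus hinj hd
  obtain ⟨ε, hε, hε1, hA⟩ := exists_annulus_subset (hV.mem_nhdsSet.2 hsV)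
  have hinjA : InjOn (param r n a) {v | |‖v‖ - 1| < ε} := hVi.mono fun v hv => hA v hv
  obtain ⟨s, hs, m, hm, hwind⟩ := exists_halfAnnulus_hasWinding hinj hd hε hε1 hinjA
  have hm0 : m ≠ 0 := by rcases hm with rfl | rfl <;> norm_num
  have hAD : ∀ v ∈ halfAnnulus s ε, param r n a v ∈ interiorDomain γ := fun v hv =>
    mem_interiorDomain_of_hasWinding continuousOn_param hm0 (hwind v hv)
  have hone : (1 : ℂ) ∈ sphere (0 : ℂ) 1 := by simp
  obtain ⟨z₀, hz₀⟩ : ∃ z₀, HasWinding (fun w => param r n a w - z₀) m :=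
    ⟨_, hwind _ (one_add_mul_mem_halfAnnulus hs ⟨half_pos hε, half_lt_self hε⟩ hε1.le hone)⟩
  obtain ⟨d, hd0, hdz⟩ : ∃ d > 0, ∀ w ∈ sphere (0 : ℂ) 1, d ≤ ‖param r n a w - z₀‖ := by
    obtain ⟨w₁, hw₁, h1⟩ := (isCompact_sphere (0 : ℂ) 1).exists_isMinOn ⟨1, hone⟩
      ((continuousOn_param (r := r) (n := n) (a := a)).sub continuousOn_const).norm
    exact ⟨_, norm_pos_iff.2 (hz₀.ne_zero hw₁), fun w hw => h1 hw⟩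
  -- `d` bounds from below the distance from `z₀` to `γ`. Moving the curve by less than `d / 2`
  -- keeps `ball z₀ (d / 2)` inside it, and the tolerance `d / 16` becomes `d / 8` inside, less than
  -- the radius `d / 4` of the test disc.
  have hnear : {v : ℂ | param r n a v ∈ Ω ∧ S (param r n a v) = dual r n a v ∧
      ‖dual r n a v - conj (param r n a v)‖ < d / 16 ∧
      ‖param r n a v - param r n a (v / ‖v‖)‖ < d / 2} ∈ 𝓝ˢ (sphere (0 : ℂ) 1) := by
    refine mem_nhdsSet_iff_forall.2 fun w hw => ?_
    have hw0 := ne_zero_of_mem_sphere hw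
    have hpc := (analyticAt_param (r := r) (n := n) (a := a) hw0).continuousAt
    have hdc := (analyticAt_dual (r := r) (n := n) (a := a) hw0).continuousAt
    have hw1 : w / (‖w‖ : ℂ) = w := by simp [mem_sphere_zero_iff_norm.1 hw]
    have hnc : ContinuousAt (fun v : ℂ => v / (‖v‖ : ℂ)) w :=
      continuousAt_id.div (by fun_prop) (by simpa using hw0)
    have hpc2 : ContinuousAt (fun v : ℂ => param r n a (v / (‖v‖ : ℂ))) w :=
      ContinuousAt.comp (g := param r n a) (by rwa [hw1]) hnc
    refine (hpc.eventually (hS.isOpen.eventually_mem (hS.subset ⟨w, hw, rfl⟩))).and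
      ((hS.eventually_comp_param hw).and (((hdc.sub
        (Complex.continuous_conj.continuousAt.comp hpc)).norm.eventually
          (eventually_lt_nhds ?_)).and ((hpc.sub hpc2).norm.eventually (eventually_lt_nhds ?_))))
    · change ‖dual r n a w - conj (param r n a w)‖ < d / 16
      rw [dual_eq_conj_param hw, sub_self, norm_zero]
      positivity
    · change ‖param r n a w - param r n a (w / ‖w‖)‖ < d / 2
      rw [hw1, sub_self, norm_zero]
      positivity
  obtain ⟨ε', hε', -, hA'⟩ := exists_annulus_subset hnear
  set t := min ε ε' / 2 with ht
  have htm : t ∈ Ioo 0 (min ε ε') := ⟨by positivity, half_lt_self (lt_min hε hε')⟩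
  have htmem : ∀ τ ∈ Ioc (0 : ℝ) 1, ∀ w ∈ sphere (0 : ℂ) 1,
      ((1 + s * (τ * t) : ℝ) : ℂ) * w ∈ halfAnnulus s ε ∧
        |‖((1 + s * (τ * t) : ℝ) : ℂ) * w‖ - 1| < ε' := by
    intro τ hτ w hw
    have h1 : τ * t ∈ Ioo 0 (min ε ε') :=
      ⟨mul_pos hτ.1 htm.1, (mul_le_of_le_one_left htm.1.le hτ.2).trans_lt htm.2⟩
    have h2 := one_add_mul_mem_halfAnnulus hs h1 ((min_le_left _ _).trans hε1.le) hw
    exact ⟨⟨h2.1, h2.2.trans_le (min_le_left _ _)⟩,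
      (abs_norm_sub_one_lt hs h2).trans_le (min_le_right _ _)⟩
  -- The parallel curve `c` is the image of the circle of radius `x`, on the side of index `±1`.
  set x : ℝ := 1 + s * t with hx
  have hxw : ∀ w ∈ sphere (0 : ℂ) 1, (x : ℂ) * w ∈ halfAnnulus s ε ∧ |‖(x : ℂ) * w‖ - 1| < ε' :=
    fun w hw => by simpa [hx] using htmem 1 ⟨one_pos, le_rfl⟩ w hw
  have hx0 : 0 < x := by
    have h1 := abs_norm_sub_one_lt hs (hxw 1 hone).1
    rw [hx]
    rcases hs with rfl | rfl <;> linarith [htm.1, htm.2, min_le_left ε ε']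
  have hxc : (x : ℂ) ≠ 0 := Complex.ofReal_ne_zero.2 hx0.ne'
  set c : ℂ → ℂ := fun w => param r n a (x * w) with hcdef
  have hc : ContinuousOn c (sphere 0 1) := fun w hw => by
    have h1 : (x : ℂ) * w ≠ 0 := mul_ne_zero hxc (ne_zero_of_mem_sphere hw)
    exact (ContinuousAt.comp (g := param r n a) (analyticAt_param h1).continuousAt
      (by fun_prop)).continuousWithinAt
  have hci : InjOn c (sphere 0 1) := fun w hw w' hw' h =>
    mul_left_cancel₀ hxc (hinjA (abs_norm_sub_one_lt hs (hxw w hw).1)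
      (abs_norm_sub_one_lt hs (hxw w' hw').1) h)
  -- The inside of the parallel curve is defined by its index; local constancy makes `D` open and
  -- `D` together with the curve closed.
  set D : Set ℂ := {z | z ∉ c '' sphere 0 1 ∧ HasWinding (fun w => c w - z) m} with hD
  have hDopen : IsOpen D := by
    rw [isOpen_iff_mem_nhds]
    rintro z ⟨hz, hzm⟩
    exact (HasWinding.eventually_sub_iff hc hz).mono fun y hy => ⟨hy.1, (hy.2 m).2 hzm⟩
  have hDdisj : Disjoint D (c '' sphere 0 1) := disjoint_left.2 fun z hz => hz.1
  have hKc : IsClosed (D ∪ c '' sphere 0 1) := by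
    rw [← isOpen_compl_iff, isOpen_iff_mem_nhds]
    intro z hz
    rw [mem_compl_iff, mem_union, not_or] at hz
    refine (HasWinding.eventually_sub_iff hc hz.2).mono fun y hy => ?_
    rw [mem_union, not_or]
    exact ⟨fun h => hz.1 ⟨hz.2, (hy.2 m).1 h.2⟩, hy.1⟩
  have hball : ball z₀ (d / 2) ⊆ D := by
    intro z hz
    have h1 : HasWinding (fun w => c w - z) m := by
      refine hz₀.of_norm_sub_lt (continuousOn_param.sub continuousOn_const)
        (hc.sub continuousOn_const) fun w hw => lt_of_lt_of_le ?_ (hdz w hw)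
      have h2 := (hA' _ (hxw w hw).2).2.2.2
      have h3 : (x : ℂ) * w / (‖(x : ℂ) * w‖ : ℂ) = w := by
        rw [norm_mul, mem_sphere_zero_iff_norm.1 hw, Complex.norm_real, Real.norm_of_nonneg hx0.le,
          mul_one, mul_div_cancel_left₀ _ hxc]
      rw [h3] at h2
      rw [mem_ball, dist_eq_norm] at hz
      have h4 : c w - z - (param r n a w - z₀) = (c w - param r n a w) - (z - z₀) := by ring
      rw [h4]
      linarith [norm_sub_le (c w - param r n a w) (z - z₀)]
    refine ⟨?_, h1⟩
    rintro ⟨w, hw, rfl⟩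
    exact h1.ne_zero hw (sub_self _)
  have hz₀D : z₀ ∈ D := hball (mem_ball_self (half_pos hd0))
  have hKD : ∀ z ∈ D ∪ c '' sphere 0 1, z ∈ interiorDomain γ := by
    rintro z (hz | ⟨w, hw, rfl⟩)
    · exact mem_interiorDomain_of_hasWinding_of_hasWinding hinj hc hm0
        (fun v hv => hwind _ (hxw v hv).1) hz.2
    · exact hAD _ (hxw w hw).1
  obtain ⟨R, hR, hRK, hRid⟩ := exists_retraction hc hci hm hDopen hDdisj hKc hz₀D hz₀D.2
  have hSan : ∀ v : ℂ, |‖v‖ - 1| < ε' → AnalyticAt ℂ S (param r n a v) := fun v hv =>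
    hS.analytic _ (hA' v hv).1
  have hx₀ : c 1 ∈ c '' sphere 0 1 := ⟨1, hone, rfl⟩
  -- The radial path from `h 1` to `c 1` enters the interior domain at once and stays where `S` is
  -- analytic.
  have hacc : IsAccessible r n a S γ (interiorDomain γ) (c 1) S := by
    let e : Path (param r n a 1) (c 1) :=
      { toFun := fun τ => param r n a ((1 + s * (τ * t) : ℝ) : ℂ)
        continuous_toFun := by
          refine continuous_iff_continuousAt.2 fun τ => ?_
          refine ContinuousAt.comp (g := param r n a) (analyticAt_param ?_).continuousAt
            (by fun_prop)
          rw [Complex.ofReal_ne_zero]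
          have h1 : (τ : ℝ) * t ≤ t := mul_le_of_le_one_left htm.1.le τ.2.2
          have h2 : 0 ≤ (τ : ℝ) * t := mul_nonneg τ.2.1 htm.1.le
          rcases hs with rfl | rfl <;> linarith [htm.2, min_le_left ε ε']
        source' := by simp
        target' := by simp [hcdef, hx] }
    have he : ∀ τ : I, 0 < τ → e τ = param r n a (((1 + s * (τ * t) : ℝ) : ℂ) * 1) := fun τ _ => by
      rw [mul_one]
      rfl
    have he1 : ContinuesTo e S S := by
      refine ContinuesTo.of_analyticAt fun τ => ?_
      rcases eq_or_lt_of_le (show (0 : I) ≤ τ from τ.2.1) with rfl | hτ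
      · rw [e.source]
        exact hS.analytic _ (hS.subset ⟨1, hone, rfl⟩)
      · rw [he τ hτ]
        exact hSan _ (htmem τ ⟨hτ, τ.2.2⟩ 1 hone).2
    refine ⟨he1.isAlgGerm hn hr ha (hS.isAlgGerm hd ⟨1, hone, rfl⟩), _, ⟨1, hone, rfl⟩, e,
      fun τ hτ => ?_, he1⟩
    rw [he τ hτ]
    exact hAD _ (htmem τ ⟨hτ, τ.2.2⟩ 1 hone).1
  -- The retracted segments stay in the filled parallel curve, hence in the interior domain, where
  -- by assumption nothing branches.
  have hcont : ∀ y, ∃ g, ContinuesTo (segmentPath hR (c 1) y) S g := fun y => by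
    have h1 : R (c 1) = c 1 := hRid _ (Or.inr hx₀)
    refine exists_continuesTo_of_forall_ball (U := interiorDomain γ)
      (P := IsAccessible r n a S γ (interiorDomain γ))
      (fun p hp => IsAccessible.exists_extension hn hr ha hDo hp (hnb p hp)) _
      (fun τ => hKD _ (hRK _)) ?_ ?_
    · rw [h1]; exact hacc.analyticAt
    · rw [h1]; exact hacc
  obtain ⟨f, hf, hfS⟩ := exists_diffContOnCl_of_continuesTo hc hDopen rfl hKc hR hRid hx₀
    (fun z ⟨w, hw, hz⟩ => hz ▸ hSan _ (hxw w hw).2) hcont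
  have hDb : Bornology.IsBounded D := by
    obtain ⟨B, hB⟩ := (isCompact_sphere (0 : ℂ) 1).exists_bound_of_continuousOn hc
    refine isBounded_iff_forall_norm_le.2 ⟨B, fun z hz => ?_⟩
    by_contra! h
    exact hm0 (hz.2.unique (HasWinding.sub_of_forall_norm_lt hc fun w hw => (hB w hw).trans_lt h))
  have hfr : ∀ z ∈ frontier D, ‖f z - conj z‖ ≤ d / 16 := by
    intro z hz
    rw [hDopen.frontier_eq] at hz
    obtain ⟨w, hw, rfl⟩ := (closure_minimal subset_union_left hKc hz.1).resolve_left hz.2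
    have h1 := hA' _ (hxw w hw).2
    rw [hfS ⟨w, hw, rfl⟩, hcdef]
    simp only
    rw [h1.2.1]
    exact h1.2.2.1.le
  have hsub : closedBall z₀ (d / 4) ⊆ D := (closedBall_subset_ball (by linarith)).trans hball
  have := le_of_forall_norm_sub_conj_le (C := 2 * (d / 16)) (show 0 < d / 4 by positivity)
    (hf.mono (ball_subset_closedBall.trans hsub)) fun z hz =>
      norm_sub_conj_le_of_forall_frontier hDb hf hfr (subset_closure (hsub (sphere_subset_closedBall hz)))
  linarith

end

end PolyCurve

end

theorem mainTheorem6 (n : ℕ) (hn : 1 ≤ n) (γ : Set ℂ)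
    (hγ : PolyCurve.IsSimpleAnalyticPolynomialCurve n γ) :
    (∃ (Ω : Set ℂ) (S : ℂ → ℂ), PolyCurve.IsSchwarzFunction γ Ω S) ∧
    ∀ (Ω : Set ℂ) (S : ℂ → ℂ), PolyCurve.IsSchwarzFunction γ Ω S →
      (∃ p ∈ PolyCurve.interiorDomain γ,
        PolyCurve.IsBranchPoint S γ (PolyCurve.interiorDomain γ) p) ∧
      ∃ N : Set ℂ, IsOpen N ∧ γ ⊆ N ∧ N ⊆ Ω ∧
        ∀ p ∈ N, ¬ PolyCurve.IsBranchPoint S γ Ω p ∧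
          ¬ PolyCurve.IsBranchPoint S γ (PolyCurve.interiorDomain γ) p := by
  obtain ⟨r, a, hr, ha, rfl, hinj, hd⟩ := hγ
  refine ⟨PolyCurve.exists_isSchwarzFunction hinj hd, fun Ω S hS =>
    ⟨hS.exists_isBranchPoint hn hr ha hinj hd, ?_⟩⟩
  have hC := PolyCurve.finite_criticalValues (n := n) (a := a) hr
  -- A critical value may lie on `γ`, attained off the circle. It stays in `N` but is no branch
  -- point in the interior domain, which is disjoint from `γ`.
  refine ⟨Ω \ (PolyCurve.criticalValues r n a \ PolyCurve.param r n a '' sphere 0 1),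
    hS.isOpen.sdiff (hC.subset sdiff_subset).isClosed, fun z hz => ⟨hS.subset hz, fun h => h.2 hz⟩,
    sdiff_subset, fun p hp => ⟨hS.not_isBranchPoint p, fun hb => ?_⟩⟩
  refine hp.2 ⟨hS.mem_criticalValues_of_isBranchPoint hn hr ha hd hb, ?_⟩
  obtain ⟨ε, hε, hsub, -⟩ := hb
  exact (hsub (mem_ball_self hε)).1
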